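/- For a partition $\lambda=(\lambda_1\ge\lambda_2\ge\cdots)$ of $d$ put $p_3(\lambda)=\sum_{i\ge 1}\big[(\lambda_i-i+\tfrac12)^3-(-i+\tfrac12)^3\big]$, and let $\chi^\lambda_\mu$ be the irreducible character of the symmetric group $S_d$ attached to $\lambda$, evaluated at permutations of cycle type $\mu$. For integers $g\ge 0$, $d\ge 1$ and a partition $\beta=(\beta_1,\dots,\beta_n)$ of $d$ with an odd number $n$ of parts, let $s=g+\frac{n-1}{2}$ and define the one-part double Hurwitz number with completed $3$-cycles by $$H^{g,(2)}_{(d),\beta}=\frac{1}{d\,\prod_{j}\beta_j}\sum_{\lambda\vdash d}\chi^\lambda_{(d)}\left(\frac{p_3(\lambda)}{3!}\right)^{s}\chi^\lambda_\beta .$$ **Corollary 4.1 (strong polynomiality).** Fix $g\ge 0$ and an odd $n\ge 1$ with $(g,n)\neq(0,1)$. Then there is a polynomial $P\in\mathbb{Q}[x_1,\dots,x_n]$, depending only on $g$ and $n$, such that $H^{g,(2)}_{(d),\beta}=P(\beta_1,\dots,\beta_n)$ for every $d$ and every partition $\beta$ of $d$ with exactly $n$ parts, the parts $\beta_1,\dots,\beta_n$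 being listed in any order. The largest and the smallest degree of a nonzero homogeneous component of $P$ are $3g+\frac{n-3}{2}$ and $g+\frac{n-3}{2}$ respectively. -/

import Mathlib

noncomputable section

namespace Hurwitz

open Equiv

/-- The Young diagram (English convention: cells `(row, column)`, both indexed from `0`) whose row
lengths are the parts of `p` in weakly decreasing order. -/
def diagram {d : ℕ} (p : d.Partition) : YoungDiagram :=
  YoungDiagram.ofRowLens (p.parts.sort (· ≥ ·)) (p.parts.pairwise_sort (· ≥ ·)).sortedGE

/-- The symmetric group on the cells of a Young diagram with `d` cells; a copy of `S_d` in which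
the tableau filling is the tautological one. -/
abbrev CellPerm (Y : YoungDiagram) : Type := Perm Y.cells

open Classical in
/-- The row symmetrizer: the sum of all permutations preserving every row. -/
def rowSymmetrizer (Y : YoungDiagram) : MonoidAlgebra ℚ (CellPerm Y) :=
  ∑ σ : CellPerm Y with ∀ c, (σ c).1.1 = c.1.1, MonoidAlgebra.of ℚ (CellPerm Y) σ

open Classical in
/-- The column antisymmetrizer: the signed sum of all permutations preserving every column. -/
def colAntisymmetrizer (Y : YoungDiagram) : MonoidAlgebra ℚ (CellPerm Y) :=
  ∑ σ : CellPerm Y with ∀ c, (σ c).1.2 = c.1.2,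
    ((Perm.sign σ : ℤ) : ℚ) • MonoidAlgebra.of ℚ (CellPerm Y) σ

/-- The Young symmetrizer. -/
def youngSymmetrizer (Y : YoungDiagram) : MonoidAlgebra ℚ (CellPerm Y) :=
  rowSymmetrizer Y * colAntisymmetrizer Y

/-- The Specht module: the left ideal of the group algebra generated by the Young symmetrizer. -/
abbrev SpechtModule (Y : YoungDiagram) : Ideal (MonoidAlgebra ℚ (CellPerm Y)) :=
  Ideal.span {youngSymmetrizer Y}

/-- The irreducible representation of the symmetric group attached to a Young diagram: left
multiplication on the Specht module. -/
def spechtRep (Y : YoungDiagram) : Representation ℚ (CellPerm Y) (SpechtModule Y) :=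
  (Algebra.lsmul ℚ ℚ (SpechtModule Y)).toMonoidHom.comp (MonoidAlgebra.of ℚ (CellPerm Y))

theorem card_cellsOfRowLens (w : List ℕ) : (YoungDiagram.cellsOfRowLens w).card = w.sum := by
  induction w with
  | nil => simp [YoungDiagram.cellsOfRowLens]
  | cons a w ih =>
    rw [YoungDiagram.cellsOfRowLens, Finset.card_union_of_disjoint]
    · simp [ih]
    · rw [Finset.disjoint_left]
      rintro ⟨i, j⟩ h1 h2
      simp at h1 h2
      omega

theorem card_cells_diagram {d : ℕ} (p : d.Partition) : Fintype.card (diagram p).cells = d := by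
  have h : (p.parts.sort (· ≥ ·)).sum = d := by
    rw [← Multiset.sum_coe, Multiset.sort_eq, p.parts_sum]
  simpa [diagram, YoungDiagram.ofRowLens, h] using card_cellsOfRowLens (p.parts.sort (· ≥ ·))

/-- Every partition of `d` is the cycle type (fixed points included) of a permutation of `d`
objects. -/
theorem exists_perm_parts {d : ℕ} (p q : d.Partition) :
    ∃ σ : CellPerm (diagram p), σ.partition.parts = q.parts := by
  have hsplit : q.parts.filter (2 ≤ ·) + q.parts.filter (¬ 2 ≤ ·) = q.parts :=
    Multiset.filter_add_not _ _
  have hone : q.parts.filter (¬ 2 ≤ ·)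
      = Multiset.replicate (Multiset.card (q.parts.filter (¬ 2 ≤ ·))) 1 := by
    refine Multiset.eq_replicate_card.2 fun x hx => ?_
    have h1 := Multiset.mem_filter.1 hx
    have h2 := q.parts_pos h1.1
    omega
  have hsum : (q.parts.filter (2 ≤ ·)).sum + Multiset.card (q.parts.filter (¬ 2 ≤ ·)) = d := by
    have h := congrArg Multiset.sum hsplit
    rw [Multiset.sum_add, q.parts_sum, hone, Multiset.sum_replicate] at h
    simpa using h
  obtain ⟨σ, hσ⟩ := (Perm.exists_with_cycleType_iff (diagram p).cells
    (m := q.parts.filter (2 ≤ ·))).2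
    ⟨by rw [card_cells_diagram]; omega, fun a ha => (Multiset.mem_filter.1 ha).2⟩
  refine ⟨σ, ?_⟩
  rw [Perm.parts_partition, ← Perm.sum_cycleType, hσ, card_cells_diagram]
  conv_rhs => rw [← hsplit, hone]
  congr 2
  omega

/-- `chi p q` is `χ^p_q`: the irreducible character attached to `p`, evaluated at a permutation
of cycle type `q`. -/
def chi {d : ℕ} (p q : d.Partition) : ℚ :=
  (spechtRep (diagram p)).character (exists_perm_parts p q).choose

/-- The shifted symmetric power sum `p_k` at a partition. Row `i` (counted from `0`) is the part
with index `i + 1`; the terms beyond the last part vanish, so the sum is finite. -/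
def shiftedPowerSum (k : ℕ) {d : ℕ} (p : d.Partition) : ℚ :=
  ∑ᶠ i : ℕ, ((((diagram p).rowLen i : ℚ) - ((i : ℚ) + 1) + 1 / 2) ^ k
    - (-((i : ℚ) + 1) + 1 / 2) ^ k)

/-- The disconnected double Hurwitz number `H^{g,(r)}_{α,β}` with completed `(r+1)`-cycles. The
number `s` of completed cycles is determined by `r s = 2 g - 2 + ℓ(α) + ℓ(β)`, as the
hypothesis `hs` records. -/
def doubleHurwitz {d : ℕ} (g r s : ℕ) (α β : d.Partition)
    (_hs : r * s + 2 = 2 * g + Multiset.card α.parts + Multiset.card β.parts) : ℚ :=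
  1 / ((α.parts.prod : ℚ) * (β.parts.prod : ℚ)) *
    ∑ p : d.Partition,
      chi p α * (shiftedPowerSum (r + 1) p / ((r + 1).factorial : ℚ)) ^ s * chi p β

/-- The set of degrees of the nonzero homogeneous components of a polynomial. -/
def homogeneousDegrees {n : ℕ} (P : MvPolynomial (Fin n) ℚ) : Set ℕ :=
  {k | MvPolynomial.homogeneousComponent k P ≠ 0}

end Hurwitz

end

/-! Only hooks contribute to the sum. For the hook `(d - k, 1, …, 1)` the character is `(-1)^k` at
the long cycle and `(-1)^k [X^k] R` at `β`, where `R = ∏ (1 - X^{β_i}) / (1 - X)`, while `p_3 / 3! =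
(d/2) (u² + d²/12)` with `u = k + 1/2 - d/2`. Expanding the `s`-th power leaves the even moments
`∑_k R_k u^{2m}`. Putting `X = e^t` shows that the moments have exponential generating function `∏
β_i · t^{n-1} · ∏ S(β_i t) / S(t)`, where `S(t) = sinh(t/2) / (t/2)` (`sum_coeff_hookPoly_mul_pow`).

Let `n = 2h + 1` and `s = g + h`. Moments with `m < h` vanish, `∏ β_i` cancels, and `m = h + j`
gives a positive multiple of `d^{s-1+2(g-j)} [t^{2j}] ∏ S(β_i t) / S(t)`, a polynomial because `d =
∑ β_i` and `s ≥ 1`. The lowest degree `s - 1` arises only from `j = g` and the coefficient of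
`t^{2g}` in `1/S`, a nonzero multiple of a Bernoulli number. The highest degree `s - 1 + 2g`
receives from every `j` a contribution that is nonnegative at `(1, …, 1)`, so nothing cancels.

The characters are computed inside the group algebra. A quasi-idempotent `c`, with `c² = h c`,
generates a left ideal whose character is a class average of `c` divided by `h`
(`character_leftIdealRep`). For hook symmetrizers the averages satisfy a Pieri-type recursion: two
neighbouring hooks add up to the representation induced from trivial ⊠ sign, whose values are signed
counts of invariant subsets with generating function `∏ (1 - X^m)`. For any other shape, the
alternating sum of hook characters, read as a central element, is supported on long cycles (`R(1) =
0` as soon as there are two parts) and annihilates the Young symmetrizer by pigeonhole. Taking its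
trace kills the character at the long cycle (`character_longCycle_eq_zero`). -/

noncomputable section

namespace Hurwitz

open Equiv MonoidAlgebra

/-! ### Twisted subgroup sums and class averages in a finite group algebra -/

section GroupAlgebra

variable {G : Type*} [Group G]

/-- The rational value of a quadratic character of a group. -/
def signValue (ε : G →* ℤˣ) (σ : G) : ℚ := ((ε σ : ℤ) : ℚ)

theorem signValue_one (ε : G →* ℤˣ) : signValue ε 1 = 1 := by simp [signValue]

theorem signValue_mul (ε : G →* ℤˣ) (σ τ : G) :
    signValue ε (σ * τ) = signValue ε σ * signValue ε τ := by simp [signValue]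

theorem signValue_mul_self (ε : G →* ℤˣ) (σ : G) : signValue ε σ * signValue ε σ = 1 := by
  rcases Int.units_eq_one_or (ε σ) with h | h <;> simp [signValue, h]

theorem signValue_inv (ε : G →* ℤˣ) (σ : G) : signValue ε σ⁻¹ = signValue ε σ := by
  simp [signValue]

variable [Fintype G]

open Classical in
/-- The sum of the elements of a subgroup, weighted by a quadratic character. -/
def twistedSum (ε : G →* ℤˣ) (H : Subgroup G) : MonoidAlgebra ℚ G :=
  ∑ σ : G with σ ∈ H, signValue ε σ • of ℚ G σ

theorem of_mul_twistedSum (ε : G →* ℤˣ) {H : Subgroup G} {σ : G} (hσ : σ ∈ H) :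
    of ℚ G σ * twistedSum ε H = signValue ε σ • twistedSum ε H := by
  classical
  rw [twistedSum, Finset.mul_sum, Finset.smul_sum]
  refine Finset.sum_bij' (fun τ _ => σ * τ) (fun τ _ => σ⁻¹ * τ) ?_ ?_ ?_ ?_ ?_
  · intro τ hτ
    simpa using H.mul_mem hσ (by simpa using hτ)
  · intro τ hτ
    simpa using H.mul_mem (H.inv_mem hσ) (by simpa using hτ)
  · intro τ _; simp
  · intro τ _; simp
  · intro τ _
    rw [smul_smul, signValue_mul, ← mul_assoc, signValue_mul_self, one_mul, mul_smul_comm, map_mul]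

theorem twistedSum_mul_of (ε : G →* ℤˣ) {H : Subgroup G} {σ : G} (hσ : σ ∈ H) :
    twistedSum ε H * of ℚ G σ = signValue ε σ • twistedSum ε H := by
  classical
  rw [twistedSum, Finset.sum_mul, Finset.smul_sum]
  refine Finset.sum_bij' (fun τ _ => τ * σ) (fun τ _ => τ * σ⁻¹) ?_ ?_ ?_ ?_ ?_
  · intro τ hτ
    simpa using H.mul_mem (by simpa using hτ) hσ
  · intro τ hτ
    simpa using H.mul_mem (by simpa using hτ) (H.inv_mem hσ)
  · intro τ _; simp
  · intro τ _; simp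
  · intro τ _
    rw [smul_smul, signValue_mul, mul_comm (signValue ε τ), ← mul_assoc, signValue_mul_self,
      one_mul, smul_mul_assoc, map_mul]

theorem twistedSum_mul_twistedSum_of_le (ε : G →* ℤˣ) {H L : Subgroup G} (h : L ≤ H) :
    twistedSum ε H * twistedSum ε L = (Nat.card L : ℚ) • twistedSum ε H := by
  classical
  rw [twistedSum.eq_def ε L, Finset.mul_sum]
  rw [Finset.sum_congr rfl (g := fun _ => twistedSum ε H)]
  · rw [Finset.sum_const, ← Nat.cast_smul_eq_nsmul ℚ, Nat.card_eq_fintype_card,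
      Fintype.card_subtype]
  · intro σ hσ
    rw [mul_smul_comm, twistedSum_mul_of ε (h (by simpa using hσ)), smul_smul, signValue_mul_self,
      one_smul]

theorem commute_twistedSum (ε : G →* ℤˣ) {H : Subgroup G} {u : MonoidAlgebra ℚ G}
    (h : ∀ σ ∈ H, Commute u (of ℚ G σ)) : Commute u (twistedSum ε H) := by
  classical
  refine Commute.sum_right _ _ _ fun σ hσ => ?_
  exact (h σ (by simpa using hσ)).smul_right _

/-- The sum of the coefficients of an element of the group algebra over the conjugates of a group
element. -/
def classAverage (σ : G) : MonoidAlgebra ℚ G →ₗ[ℚ] ℚ :=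
  ∑ τ : G, Finsupp.lapply (τ⁻¹ * σ * τ) ∘ₗ (coeffLinearEquiv ℚ).toLinearMap

theorem classAverage_apply (σ : G) (u : MonoidAlgebra ℚ G) :
    classAverage σ u = ∑ τ : G, u.coeff (τ⁻¹ * σ * τ) := by
  simp [classAverage, LinearMap.sum_apply]

theorem classAverage_of_mul (σ π : G) (u : MonoidAlgebra ℚ G) :
    classAverage σ (of ℚ G π * u) = classAverage σ (u * of ℚ G π) := by
  simp only [classAverage_apply, of_apply, coeff_single_mul_apply, coeff_mul_single_apply, one_mul,
    mul_one]
  refine Fintype.sum_equiv (Equiv.mulRight π) _ _ fun τ => ?_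
  congr 1
  simp [mul_assoc]

theorem classAverage_mul_comm (σ : G) (u v : MonoidAlgebra ℚ G) :
    classAverage σ (u * v) = classAverage σ (v * u) := by
  induction u using MonoidAlgebra.induction_on with
  | of π => exact classAverage_of_mul σ π v
  | add x y hx hy => simp only [add_mul, mul_add, map_add, hx, hy]
  | smul r x hx => simp only [smul_mul_assoc, mul_smul_comm, map_smul, hx]

/-- The sum of all conjugates of an element of the group algebra. -/
def conjSum (u : MonoidAlgebra ℚ G) : MonoidAlgebra ℚ G :=
  ∑ τ : G, of ℚ G τ * u * of ℚ G τ⁻¹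

theorem coeff_conjSum (u : MonoidAlgebra ℚ G) (σ : G) :
    (conjSum u).coeff σ = classAverage σ u := by
  rw [conjSum, coeff_sum, Finset.sum_apply', classAverage_apply]
  refine Finset.sum_congr rfl fun τ _ => ?_
  simp [of_apply, coeff_single_mul_apply, coeff_mul_single_apply, mul_assoc]

theorem conjSum_mul_comm (u v : MonoidAlgebra ℚ G) : conjSum (u * v) = conjSum (v * u) := by
  ext σ
  rw [coeff_conjSum, coeff_conjSum, classAverage_mul_comm]

theorem conjSum_commute (u v : MonoidAlgebra ℚ G) : Commute (conjSum u) v := by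
  induction v using MonoidAlgebra.induction_on with
  | of π =>
    rw [commute_iff_eq, conjSum, Finset.sum_mul, Finset.mul_sum]
    refine Fintype.sum_equiv (Equiv.mulLeft π⁻¹) _ _ fun τ => ?_
    simp only [Equiv.coe_mulLeft, mul_inv_rev, inv_inv, map_mul]
    simp only [← mul_assoc]
    rw [← map_mul, mul_inv_cancel, map_one, one_mul]
  | add x y hx hy => exact hx.add_right hy
  | smul r x hx => exact hx.smul_right r

end GroupAlgebra

/-! ### Traces on principal left ideals of a finite group algebra -/

section Trace

variable {G : Type*} [Group G] [Fintype G]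

/-- Left multiplication on the left ideal generated by an element of the group algebra. -/
def leftIdealRep (c : MonoidAlgebra ℚ G) :
    Representation ℚ G (Ideal.span {c} : Ideal (MonoidAlgebra ℚ G)) :=
  (Algebra.lsmul ℚ ℚ (Ideal.span {c} : Ideal (MonoidAlgebra ℚ G))).toMonoidHom.comp (of ℚ G)

/-- The diagonal entry at the basis element `τ` is the coefficient of `τ` in `σ τ e`, namely that of
`τ⁻¹ σ⁻¹ τ` in `e`; hence the inverse. -/
theorem trace_mul_mul (e : MonoidAlgebra ℚ G) (σ : G) :
    LinearMap.trace ℚ (MonoidAlgebra ℚ G)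
      (LinearMap.mulLeft ℚ (of ℚ G σ) ∘ₗ LinearMap.mulRight ℚ e) = classAverage σ⁻¹ e := by
  classical
  rw [LinearMap.trace_eq_matrix_trace ℚ (MonoidAlgebra.basis G ℚ), Matrix.trace,
    classAverage_apply]
  refine Finset.sum_congr rfl fun τ _ => ?_
  rw [Matrix.diag_apply, LinearMap.toMatrix_apply]
  simp [MonoidAlgebra.basis, of_apply, coeff_single_mul_apply, mul_assoc]

/-- Right multiplication by the idempotent `h⁻¹ c` projects the whole algebra onto the ideal and
commutes with left multiplication, so the trace on the ideal equals a trace on the group algebra. -/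
theorem character_leftIdealRep {c : MonoidAlgebra ℚ G} {h : ℚ} (hh : h ≠ 0)
    (hc : c * c = h • c) (σ : G) :
    (leftIdealRep c).character σ = classAverage σ⁻¹ c / h := by
  set p : Submodule ℚ (MonoidAlgebra ℚ G) :=
    (Ideal.span {c} : Ideal (MonoidAlgebra ℚ G)).restrictScalars ℚ with hp
  set f := LinearMap.mulLeft ℚ (of ℚ G σ) ∘ₗ LinearMap.mulRight ℚ (h⁻¹ • c) with hf
  have hmem : ∀ x, f x ∈ p := by
    intro x
    rw [hp, Submodule.restrictScalars_mem, hf, LinearMap.comp_apply, LinearMap.mulLeft_apply,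
      LinearMap.mulRight_apply, Ideal.mem_span_singleton']
    exact ⟨h⁻¹ • (of ℚ G σ * x), by simp [mul_assoc]⟩
  have h1 := LinearMap.trace_restrict_eq_of_forall_mem p f hmem
  have h2 : LinearMap.trace ℚ (MonoidAlgebra ℚ G) f = classAverage σ⁻¹ c / h := by
    rw [hf, trace_mul_mul, map_smul, smul_eq_mul, inv_mul_eq_div]
  rw [← h2, ← h1]
  change LinearMap.trace ℚ p _ = _
  congr 1
  ext ⟨x, hx⟩ : 2
  obtain ⟨y, rfl⟩ := Ideal.mem_span_singleton'.1 hx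
  change of ℚ G σ * (y * c) = of ℚ G σ * (y * c * (h⁻¹ • c))
  rw [mul_smul_comm, mul_assoc y, hc]
  simp only [mul_smul_comm, smul_smul]
  rw [inv_mul_cancel₀ hh, one_smul]

/-- A central `z` killing the generator kills the ideal, `z (y c) = y (z c) = 0`; the sum is the
trace of its action. -/
theorem sum_mul_character_leftIdealRep_eq_zero {c z : MonoidAlgebra ℚ G}
    (hz : ∀ u, Commute z u) (h : z * c = 0) :
    ∑ σ : G, z.coeff σ * (leftIdealRep c).character σ = 0 := by
  have h1 : ∑ σ : G, z.coeff σ • leftIdealRep c σ = 0 := by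
    ext ⟨x, hx⟩ : 2
    obtain ⟨y, rfl⟩ := Ideal.mem_span_singleton'.1 hx
    have h2 : z * (y * c) = 0 := by
      rw [← mul_assoc, (hz y).eq, mul_assoc, h, mul_zero]
    have h3 : z = ∑ σ : G, z.coeff σ • of ℚ G σ := by
      ext τ
      classical
      rw [coeff_sum, Finset.sum_apply']
      simp [of_apply, Finsupp.single_apply]
    rw [h3, Finset.sum_mul] at h2
    rw [LinearMap.sum_apply, AddSubmonoidClass.coe_finsetSum, LinearMap.zero_apply,
      ZeroMemClass.coe_zero, ← h2]
    refine Finset.sum_congr rfl fun σ _ => ?_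
    rw [smul_mul_assoc]
    rfl
  have h4 := congrArg (LinearMap.trace ℚ _) h1
  rw [map_sum, map_zero] at h4
  rw [← h4]
  refine Finset.sum_congr rfl fun σ _ => ?_
  rw [map_smul, smul_eq_mul]
  rfl

end Trace

end Hurwitz

end

noncomputable section

namespace Hurwitz

open Equiv MonoidAlgebra

/-! ### Symmetrizers and antisymmetrizers of finite sets -/

section PermsOn

variable {α : Type*}

/-- The subgroup of permutations fixing every point outside a finite set. -/
def permsOn (S : Finset α) : Subgroup (Perm α) where
  carrier := {σ | ∀ a, a ∉ S → σ a = a}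
  one_mem' := by simp
  mul_mem' := by
    intro σ τ hσ hτ a ha
    rw [Perm.mul_apply, hτ a ha, hσ a ha]
  inv_mem' := by
    intro σ hσ a ha
    rw [Perm.inv_eq_iff_eq, hσ a ha]

theorem permsOn_mono {S T : Finset α} (h : S ⊆ T) : permsOn S ≤ permsOn T :=
  fun _ hσ a ha => hσ a fun h' => ha (h h')

variable [DecidableEq α]

theorem swap_mem_permsOn {S : Finset α} {x y : α} (hx : x ∈ S) (hy : y ∈ S) :
    swap x y ∈ permsOn S := by
  intro a ha
  exact swap_apply_of_ne_of_ne (by rintro rfl; exact ha hx) (by rintro rfl; exact ha hy)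

theorem apply_mem_iff_of_mem_permsOn {S : Finset α} {σ : Perm α} (hσ : σ ∈ permsOn S) (a : α) :
    σ a ∈ S ↔ a ∈ S := by
  constructor
  · intro h
    by_contra ha
    exact ha (hσ a ha ▸ h)
  · intro h
    by_contra ha
    have := hσ _ ha
    rw [σ.injective this] at ha
    exact ha h

theorem commute_of_mem_permsOn {S T : Finset α} (h : Disjoint S T) {σ τ : Perm α}
    (hσ : σ ∈ permsOn S) (hτ : τ ∈ permsOn T) : Commute σ τ := by
  refine Perm.Disjoint.commute fun a => ?_
  by_cases ha : a ∈ S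
  · exact Or.inr (hτ a (Finset.disjoint_left.1 h ha))
  · exact Or.inl (hσ a ha)

theorem card_permsOn (S : Finset α) : Nat.card (permsOn S) = S.card.factorial := by
  refine (Nat.card_congr (Perm.subtypeEquivSubtypePerm (· ∈ S))).symm.trans ?_
  rw [Nat.card_eq_fintype_card, Fintype.card_perm, Fintype.card_coe]

/-- The sum of the transpositions exchanging a point with the points of a finite set. -/
def starSum (x : α) (S : Finset α) : MonoidAlgebra ℚ (Perm α) :=
  ∑ y ∈ S, of ℚ (Perm α) (swap x y)

theorem commute_starSum {x : α} {S : Finset α} (hx : x ∉ S) {σ : Perm α} (hσ : σ ∈ permsOn S) :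
    Commute (starSum x S) (of ℚ (Perm α) σ) := by
  rw [commute_iff_eq, starSum, Finset.sum_mul, Finset.mul_sum]
  refine Finset.sum_bij' (fun y _ => σ⁻¹ y) (fun y _ => σ y) ?_ ?_ ?_ ?_ ?_
  · exact fun y hy => (apply_mem_iff_of_mem_permsOn (Subgroup.inv_mem _ hσ) y).2 hy
  · exact fun y hy => (apply_mem_iff_of_mem_permsOn hσ y).2 hy
  · simp
  · simp
  · intro y _
    rw [← map_mul, ← map_mul, Equiv.mul_swap_eq_swap_mul]
    simp [hσ x hx]

theorem of_swap_mul_of_swap {x y z : α} (hxy : x ≠ y) (hyz : y ≠ z) :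
    of ℚ (Perm α) (swap x y) * of ℚ (Perm α) (swap x z)
      = of ℚ (Perm α) (swap x z) * of ℚ (Perm α) (swap y z) := by
  rw [← map_mul, ← map_mul]
  congr 1
  rw [Equiv.mul_swap_eq_swap_mul (swap x z) y z, swap_apply_right,
    swap_apply_of_ne_of_ne hxy.symm hyz, swap_comm y x]

variable [Fintype α]

/-- Coset decomposition: `σ * swap x (σ⁻¹ x)` fixes `x`, so `σ` factors uniquely through the
stabilizer of `x` and one transposition (or the identity). -/
theorem twistedSum_permsOn_insert (ε : Perm α →* ℤˣ) {x : α} {S : Finset α} (hx : x ∉ S) :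
    twistedSum ε (permsOn (insert x S)) = twistedSum ε (permsOn S) *
      (1 + ∑ y ∈ S, signValue ε (swap x y) • of ℚ (Perm α) (swap x y)) := by
  classical
  have h1 : (1 : MonoidAlgebra ℚ (Perm α)) + ∑ y ∈ S, signValue ε (swap x y) • of ℚ _ (swap x y)
      = ∑ y ∈ insert x S, signValue ε (swap x y) • of ℚ _ (swap x y) := by
    rw [Finset.sum_insert hx, swap_self]
    congr 1
    rw [← Perm.one_def, signValue_one, map_one, one_smul]
  rw [h1, twistedSum, twistedSum, Finset.sum_mul_sum, ← Finset.sum_product']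
  refine Finset.sum_bij' (fun σ _ => (σ * swap x (σ⁻¹ x), σ⁻¹ x)) (fun p _ => p.1 * swap x p.2)
    ?_ ?_ ?_ ?_ ?_
  · intro σ hσ
    have hσ' : σ ∈ permsOn (insert x S) := by simpa using hσ
    have hy := (apply_mem_iff_of_mem_permsOn (Subgroup.inv_mem _ hσ') x).2
      (Finset.mem_insert_self x S)
    simp only [Finset.mem_product, Finset.mem_filter, Finset.mem_univ, true_and]
    refine ⟨fun a ha => ?_, hy⟩
    by_cases hax : a = x
    · subst hax; simp
    · have ha' : a ∉ insert x S := by simp [hax, ha]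
      rw [Perm.mul_apply, swap_apply_of_ne_of_ne hax (by rintro rfl; exact ha' hy), hσ' a ha']
  · rintro ⟨σ, y⟩ hp
    simp only [Finset.mem_product, Finset.mem_filter, Finset.mem_univ, true_and] at hp ⊢
    exact Subgroup.mul_mem _ (permsOn_mono (Finset.subset_insert x S) hp.1)
      (swap_mem_permsOn (Finset.mem_insert_self x S) hp.2)
  · intro σ _
    simp [mul_assoc]
  · rintro ⟨σ, y⟩ hp
    simp only [Finset.mem_product, Finset.mem_filter, Finset.mem_univ, true_and] at hp
    have h3 : (σ * swap x y)⁻¹ x = y := by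
      rw [Perm.inv_eq_iff_eq, Perm.mul_apply, swap_apply_right, hp.1 x hx]
    simp only [h3, mul_assoc, swap_mul_self, mul_one]
  · intro σ _
    rw [smul_mul_smul_comm, ← signValue_mul, ← map_mul]
    simp [mul_assoc]

/-- The sum of all permutations fixing every point outside a finite set. -/
def symmetrizer (S : Finset α) : MonoidAlgebra ℚ (Perm α) := twistedSum 1 (permsOn S)

/-- The signed sum of all permutations fixing every point outside a finite set. -/
def antisymmetrizer (S : Finset α) : MonoidAlgebra ℚ (Perm α) := twistedSum Perm.sign (permsOn S)

theorem symmetrizer_insert {x : α} {S : Finset α} (hx : x ∉ S) :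
    symmetrizer (insert x S) = symmetrizer S * (1 + starSum x S) := by
  rw [symmetrizer, twistedSum_permsOn_insert 1 hx, symmetrizer, starSum]
  simp [signValue]

theorem symmetrizer_insert' {x : α} {S : Finset α} (hx : x ∉ S) :
    symmetrizer (insert x S) = (1 + starSum x S) * symmetrizer S := by
  rw [symmetrizer_insert hx]
  refine (Commute.add_left (Commute.one_left _) ?_).eq.symm
  exact commute_twistedSum _ fun σ hσ => commute_starSum hx hσ

theorem antisymmetrizer_insert {x : α} {S : Finset α} (hx : x ∉ S) :
    antisymmetrizer (insert x S) = antisymmetrizer S * (1 - starSum x S) := by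
  rw [antisymmetrizer, twistedSum_permsOn_insert _ hx, antisymmetrizer, starSum, sub_eq_add_neg,
    ← Finset.sum_neg_distrib]
  congr 2
  refine Finset.sum_congr rfl fun y hy => ?_
  rw [signValue, Perm.sign_swap (by rintro rfl; exact hx hy)]
  simp

theorem antisymmetrizer_insert' {x : α} {S : Finset α} (hx : x ∉ S) :
    antisymmetrizer (insert x S) = (1 - starSum x S) * antisymmetrizer S := by
  rw [antisymmetrizer_insert hx]
  refine (Commute.sub_left (Commute.one_left _) ?_).eq.symm
  exact commute_twistedSum _ fun σ hσ => commute_starSum hx hσ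

theorem symmetrizer_mul_of {S : Finset α} {σ : Perm α} (hσ : σ ∈ permsOn S) :
    symmetrizer S * of ℚ (Perm α) σ = symmetrizer S := by
  rw [symmetrizer, twistedSum_mul_of _ hσ]
  simp [signValue]

theorem of_mul_symmetrizer {S : Finset α} {σ : Perm α} (hσ : σ ∈ permsOn S) :
    of ℚ (Perm α) σ * symmetrizer S = symmetrizer S := by
  rw [symmetrizer, of_mul_twistedSum _ hσ]
  simp [signValue]

theorem antisymmetrizer_mul_swap {S : Finset α} {x y : α} (hx : x ∈ S) (hy : y ∈ S) (h : x ≠ y) :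
    antisymmetrizer S * of ℚ (Perm α) (swap x y) = -antisymmetrizer S := by
  rw [antisymmetrizer, twistedSum_mul_of _ (swap_mem_permsOn hx hy), signValue,
    Perm.sign_swap h]
  simp

theorem swap_mul_antisymmetrizer {S : Finset α} {x y : α} (hx : x ∈ S) (hy : y ∈ S) (h : x ≠ y) :
    of ℚ (Perm α) (swap x y) * antisymmetrizer S = -antisymmetrizer S := by
  rw [antisymmetrizer, of_mul_twistedSum _ (swap_mem_permsOn hx hy), signValue,
    Perm.sign_swap h]
  simp

theorem symmetrizer_mul_symmetrizer_of_subset {S T : Finset α} (h : T ⊆ S) :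
    symmetrizer S * symmetrizer T = (T.card.factorial : ℚ) • symmetrizer S := by
  rw [symmetrizer, symmetrizer, twistedSum_mul_twistedSum_of_le _ (permsOn_mono h), card_permsOn]

theorem antisymmetrizer_mul_antisymmetrizer_of_subset {S T : Finset α} (h : T ⊆ S) :
    antisymmetrizer S * antisymmetrizer T = (T.card.factorial : ℚ) • antisymmetrizer S := by
  rw [antisymmetrizer, antisymmetrizer, twistedSum_mul_twistedSum_of_le _ (permsOn_mono h),
    card_permsOn]

theorem commute_symmetrizer_of {S T : Finset α} (h : Disjoint S T) {σ : Perm α}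
    (hσ : σ ∈ permsOn T) : Commute (symmetrizer S) (of ℚ (Perm α) σ) :=
  (commute_twistedSum _ fun _ hτ =>
    ((commute_of_mem_permsOn h hτ hσ).symm.map (of ℚ (Perm α)))).symm

theorem commute_symmetrizer_antisymmetrizer {S T : Finset α} (h : Disjoint S T) :
    Commute (symmetrizer S) (antisymmetrizer T) :=
  commute_twistedSum _ fun _ hσ => commute_symmetrizer_of h hσ

end PermsOn

/-! ### The Young symmetrizer of a hook -/

section Hook

variable {α : Type*} [DecidableEq α] [Fintype α]

/-- The transposition `(y z)` is both `(x y)(x z)(x y)` and `(x z)(x y)(x z)`. The left factor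
absorbs `(x y)`, the right one absorbs `(x z)` with a sign, so the product equals its own negative.
-/
theorem symmetrizer_mul_swap_mul_antisymmetrizer {P C : Finset α} {x y z : α} (hxP : x ∈ P)
    (hxC : x ∈ C) (hy : y ∈ P) (hz : z ∈ C) (hxy : x ≠ y) (hxz : x ≠ z) (hyz : y ≠ z) :
    symmetrizer P * of ℚ (Perm α) (swap y z) * antisymmetrizer C = 0 := by
  have h1 : of ℚ (Perm α) (swap y z) =
      of ℚ (Perm α) (swap x y) * of ℚ (Perm α) (swap x z) * of ℚ (Perm α) (swap x y) := by
    rw [← map_mul, ← map_mul]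
    congr 1
    rw [Equiv.mul_swap_eq_swap_mul (swap x _) x _, mul_assoc, swap_mul_self, mul_one, swap_apply_left,
      swap_apply_of_ne_of_ne hxz.symm hyz.symm]
  have h2 : of ℚ (Perm α) (swap y z) =
      of ℚ (Perm α) (swap x z) * of ℚ (Perm α) (swap x y) * of ℚ (Perm α) (swap x z) := by
    rw [← map_mul, ← map_mul]
    congr 1
    rw [Equiv.mul_swap_eq_swap_mul (swap x _) x _, mul_assoc, swap_mul_self, mul_one, swap_apply_left,
      swap_apply_of_ne_of_ne hxy.symm hyz, swap_comm]
  have h3 : symmetrizer P * of ℚ (Perm α) (swap y z) * antisymmetrizer C =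
      symmetrizer P * of ℚ (Perm α) (swap x z) * of ℚ (Perm α) (swap x y) * antisymmetrizer C := by
    rw [h1, ← mul_assoc, ← mul_assoc, symmetrizer_mul_of (swap_mem_permsOn hxP hy)]
  have h4 : symmetrizer P * of ℚ (Perm α) (swap y z) * antisymmetrizer C =
      -(symmetrizer P * of ℚ (Perm α) (swap x z) * of ℚ (Perm α) (swap x y) *
        antisymmetrizer C) := by
    rw [h2, ← mul_assoc, ← mul_assoc, mul_assoc _ _ (antisymmetrizer C),
      swap_mul_antisymmetrizer hxC hz hxz, mul_neg]
  rw [← h3] at h4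
  have h5 := add_eq_zero_iff_eq_neg.2 h4
  rw [← two_smul ℚ] at h5
  exact (smul_eq_zero.1 h5).resolve_left two_ne_zero

/-- The Young symmetrizer of the hook with row `P` and column `insert x K`. -/
def hookSymmetrizer (P K : Finset α) (x : α) : MonoidAlgebra ℚ (Perm α) :=
  symmetrizer P * antisymmetrizer (insert x K)

/-- Splitting off `1 - starSum x K` from the second antisymmetrizer and moving `(x y)` across it
produces the star sum of `y` over the whole column. This commutes with the antisymmetrizer because
`y` is outside the column, and next to the symmetrizer only its term `(y x)` survives. -/
theorem hookSymmetrizer_mul_swap_mul_antisymmetrizer {P K : Finset α} {x y : α}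
    (hPK : Disjoint P K) (hx : x ∈ P) (hy : y ∈ P) (hxy : x ≠ y) :
    hookSymmetrizer P K x * of ℚ (Perm α) (swap x y) * antisymmetrizer (insert x K)
      = (K.card.factorial : ℚ) • hookSymmetrizer P K x := by
  have hxK : x ∉ K := Finset.disjoint_left.1 hPK hx
  have hyK : y ∉ K := Finset.disjoint_left.1 hPK hy
  have hyC : y ∉ insert x K := by simp [hyK, hxy.symm]
  have h1 : antisymmetrizer (insert x K) * of ℚ (Perm α) (swap x y) * (1 - starSum x K)
      = antisymmetrizer (insert x K) * starSum y (insert x K) := by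
    rw [mul_sub, mul_one, starSum, starSum, Finset.sum_insert hxK, mul_add, swap_comm y x,
      sub_eq_add_neg, Finset.mul_sum, Finset.mul_sum, ← Finset.sum_neg_distrib]
    congr 1
    refine Finset.sum_congr rfl fun z hz => ?_
    have hxz : x ≠ z := by rintro rfl; exact hxK hz
    have hyz : y ≠ z := by rintro rfl; exact hyK hz
    rw [mul_assoc, of_swap_mul_of_swap hxy hyz, ← mul_assoc,
      antisymmetrizer_mul_swap (by simp) (by simp [hz]) hxz, neg_mul, neg_neg]
  have h2 : antisymmetrizer (insert x K) * starSum y (insert x K)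
      = starSum y (insert x K) * antisymmetrizer (insert x K) :=
    (commute_twistedSum _ fun σ hσ => commute_starSum hyC hσ).eq.symm
  have h3 : symmetrizer P * starSum y (insert x K) * antisymmetrizer (insert x K)
      = hookSymmetrizer P K x := by
    rw [starSum, Finset.sum_insert hxK, mul_add, add_mul, symmetrizer_mul_of
      (swap_mem_permsOn hy hx), Finset.mul_sum, Finset.sum_mul, Finset.sum_eq_zero, add_zero,
      hookSymmetrizer]
    intro z hz
    exact symmetrizer_mul_swap_mul_antisymmetrizer hx (by simp) hy (by simp [hz]) hxy
      (by rintro rfl; exact hxK hz) (by rintro rfl; exact hyK hz)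
  calc hookSymmetrizer P K x * of ℚ (Perm α) (swap x y) * antisymmetrizer (insert x K)
      = symmetrizer P * (antisymmetrizer (insert x K) * of ℚ (Perm α) (swap x y) *
          (1 - starSum x K)) * antisymmetrizer K := by
        rw [← mul_assoc, ← mul_assoc, mul_assoc _ (1 - starSum x K), ← antisymmetrizer_insert' hxK,
          hookSymmetrizer]
    _ = hookSymmetrizer P K x * antisymmetrizer K := by
        rw [h1, h2, ← mul_assoc, h3]
    _ = _ := by
        rw [hookSymmetrizer, mul_assoc,
          antisymmetrizer_mul_antisymmetrizer_of_subset (Finset.subset_insert x K), mul_smul_comm]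

/-- With `p = P.card` and `k = K.card`, splitting `x` off the row gives `(k+1)!` from the identity
and `k!` from each of the `p - 1` transpositions, in all `k! (p + k)`; the remaining row symmetrizer
commutes past the column and is absorbed, giving `(p-1)!`. The scalar is the product of the hook
lengths. -/
theorem hookSymmetrizer_mul_self {P K : Finset α} {x : α} (hPK : Disjoint P K) (hx : x ∈ P) :
    hookSymmetrizer P K x * hookSymmetrizer P K x
      = ((K.card.factorial : ℚ) * ((P.card - 1).factorial : ℚ) * ((P.card + K.card : ℕ) : ℚ)) •
        hookSymmetrizer P K x := by
  have hxK : x ∉ K := Finset.disjoint_left.1 hPK hx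
  have hxE : x ∉ P.erase x := Finset.notMem_erase x P
  have hdisj : Disjoint (P.erase x) (insert x K) := by
    rw [Finset.disjoint_insert_right]
    exact ⟨hxE, hPK.mono_left (Finset.erase_subset x P)⟩
  have hP : symmetrizer P = (1 + starSum x (P.erase x)) * symmetrizer (P.erase x) := by
    rw [← symmetrizer_insert' hxE, Finset.insert_erase hx]
  have h1 : hookSymmetrizer P K x * (1 + starSum x (P.erase x)) * antisymmetrizer (insert x K)
      = ((K.card.factorial : ℚ) * ((P.card + K.card : ℕ) : ℚ)) • hookSymmetrizer P K x := by
    rw [mul_add, add_mul, mul_one, starSum, Finset.mul_sum, Finset.sum_mul,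
      Finset.sum_congr rfl (g := fun _ => (K.card.factorial : ℚ) • hookSymmetrizer P K x)]
    · rw [Finset.sum_const, Finset.card_erase_of_mem hx, ← Nat.cast_smul_eq_nsmul ℚ, smul_smul]
      nth_rw 1 [hookSymmetrizer]
      rw [mul_assoc, antisymmetrizer_mul_antisymmetrizer_of_subset subset_rfl, mul_smul_comm,
        ← hookSymmetrizer, ← add_smul, Finset.card_insert_of_notMem hxK]
      congr 1
      have hpos : 1 ≤ P.card := Finset.card_pos.2 ⟨x, hx⟩
      push_cast [Nat.factorial_succ, Nat.cast_sub hpos]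
      ring
    · intro y hy
      rw [Finset.mem_erase] at hy
      exact hookSymmetrizer_mul_swap_mul_antisymmetrizer hPK hx hy.2 hy.1.symm
  have h2 : hookSymmetrizer P K x * symmetrizer (P.erase x)
      = ((P.card - 1).factorial : ℚ) • hookSymmetrizer P K x := by
    rw [hookSymmetrizer, mul_assoc, ← (commute_symmetrizer_antisymmetrizer hdisj).eq, ← mul_assoc,
      symmetrizer_mul_symmetrizer_of_subset (Finset.erase_subset x P), smul_mul_assoc,
      Finset.card_erase_of_mem hx]
  calc hookSymmetrizer P K x * hookSymmetrizer P K x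
      = hookSymmetrizer P K x * (1 + starSum x (P.erase x)) *
          (symmetrizer (P.erase x) * antisymmetrizer (insert x K)) := by
        nth_rw 2 [hookSymmetrizer]
        rw [hP]
        simp only [mul_assoc]
    _ = hookSymmetrizer P K x * (1 + starSum x (P.erase x)) * antisymmetrizer (insert x K) *
          symmetrizer (P.erase x) := by
        rw [(commute_symmetrizer_antisymmetrizer hdisj).eq, ← mul_assoc]
    _ = _ := by
        rw [h1, smul_mul_assoc, h2, smul_smul]
        congr 1
        ring

/-- Conjugation by permutations of `P` and of `K` fixes the product of symmetrizers and moves any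
pair `(x, z)` to any other, while class averages are conjugation invariant. -/
theorem classAverage_mul_swap_eq {P K : Finset α} (hPK : Disjoint P K) {x x' z z' : α}
    (hx : x ∈ P) (hx' : x' ∈ P) (hz : z ∈ K) (hz' : z' ∈ K) (σ : Perm α) :
    classAverage σ (symmetrizer P * antisymmetrizer K * of ℚ (Perm α) (swap x' z'))
      = classAverage σ (symmetrizer P * antisymmetrizer K * of ℚ (Perm α) (swap x z)) := by
  have key : ∀ ρ : Perm α, of ℚ (Perm α) ρ⁻¹ * (symmetrizer P * antisymmetrizer K) *
      of ℚ (Perm α) ρ = symmetrizer P * antisymmetrizer K →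
      classAverage σ (symmetrizer P * antisymmetrizer K * of ℚ (Perm α) (swap (ρ x) (ρ z)))
      = classAverage σ (symmetrizer P * antisymmetrizer K * of ℚ (Perm α) (swap x z)) := by
    intro ρ hρ
    have h1 : swap (ρ x) (ρ z) = ρ * swap x z * ρ⁻¹ := by
      rw [Equiv.mul_swap_eq_swap_mul, mul_assoc, mul_inv_cancel, mul_one]
    rw [h1, map_mul (of ℚ (Perm α)), ← mul_assoc, ← classAverage_of_mul,
      map_mul (of ℚ (Perm α)), ← mul_assoc, ← mul_assoc, hρ]
  have hP : ∀ ρ ∈ permsOn P, of ℚ (Perm α) ρ⁻¹ * (symmetrizer P * antisymmetrizer K) *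
      of ℚ (Perm α) ρ = symmetrizer P * antisymmetrizer K := by
    intro ρ hρ
    rw [← mul_assoc, of_mul_symmetrizer (Subgroup.inv_mem _ hρ),
      (commute_symmetrizer_antisymmetrizer hPK).eq, mul_assoc, symmetrizer_mul_of hρ]
  have hK : ∀ ρ ∈ permsOn K, of ℚ (Perm α) ρ⁻¹ * (symmetrizer P * antisymmetrizer K) *
      of ℚ (Perm α) ρ = symmetrizer P * antisymmetrizer K := by
    intro ρ hρ
    rw [← mul_assoc, ← (commute_symmetrizer_of hPK (Subgroup.inv_mem _ hρ)).eq, mul_assoc,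
      mul_assoc, antisymmetrizer, twistedSum_mul_of _ hρ, mul_smul_comm,
      of_mul_twistedSum _ (Subgroup.inv_mem _ hρ), signValue_inv, smul_smul, signValue_mul_self,
      one_smul]
  have hne : ∀ {a b : α}, a ∈ P → b ∈ K → a ≠ b := by
    rintro a b ha hb rfl
    exact Finset.disjoint_left.1 hPK ha hb
  have h1 := key _ (hP _ (swap_mem_permsOn hx hx'))
  rw [swap_apply_left, swap_apply_of_ne_of_ne (hne hx hz).symm (hne hx' hz).symm] at h1
  rw [← h1]
  have h2 : swap x' z' = swap (swap z z' x') (swap z z' z) := by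
    rw [swap_apply_left, swap_apply_of_ne_of_ne (hne hx' hz) (hne hx' hz')]
  have h3 := hK _ (swap_mem_permsOn hz hz')
  have h4 : swap (swap z z' x') (swap z z' z) = swap z z' * swap x' z * (swap z z')⁻¹ := by
    rw [Equiv.mul_swap_eq_swap_mul, mul_assoc, mul_inv_cancel, mul_one]
  rw [h2, h4, map_mul (of ℚ (Perm α)), ← mul_assoc, ← classAverage_of_mul,
    map_mul (of ℚ (Perm α)), ← mul_assoc, ← mul_assoc, h3]

theorem classAverage_hookSymmetrizer {P K : Finset α} {x z : α} (hPK : Disjoint P K) (hx : x ∈ P)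
    (hz : z ∈ K) (σ : Perm α) :
    classAverage σ (hookSymmetrizer P K x)
      = classAverage σ (symmetrizer P * antisymmetrizer K) - (K.card : ℚ) *
        classAverage σ (symmetrizer P * antisymmetrizer K * of ℚ (Perm α) (swap x z)) := by
  have hxK : x ∉ K := Finset.disjoint_left.1 hPK hx
  rw [hookSymmetrizer, antisymmetrizer_insert hxK, mul_sub, mul_one, mul_sub, map_sub, starSum,
    Finset.mul_sum, Finset.mul_sum, map_sum]
  congr 1
  rw [← nsmul_eq_mul, ← Finset.sum_const]
  refine Finset.sum_congr rfl fun z' hz' => ?_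
  rw [← mul_assoc]
  exact classAverage_mul_swap_eq hPK hx hx hz hz' σ

theorem classAverage_hookSymmetrizer_insert {P K : Finset α} {x z : α} (hPK : Disjoint P K)
    (hx : x ∈ P) (hz : z ∈ K) (σ : Perm α) :
    classAverage σ (hookSymmetrizer (insert z P) (K.erase z) z)
      = classAverage σ (symmetrizer P * antisymmetrizer K) + (P.card : ℚ) *
        classAverage σ (symmetrizer P * antisymmetrizer K * of ℚ (Perm α) (swap x z)) := by
  have hzP : z ∉ P := Finset.disjoint_right.1 hPK hz
  rw [hookSymmetrizer, Finset.insert_erase hz, symmetrizer_insert' hzP, add_mul, one_mul, add_mul,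
    map_add, starSum, Finset.sum_mul, Finset.sum_mul, map_sum]
  congr 1
  rw [← nsmul_eq_mul, ← Finset.sum_const]
  refine Finset.sum_congr rfl fun y hy => ?_
  rw [mul_assoc, classAverage_of_mul, swap_comm]
  exact classAverage_mul_swap_eq hPK hx hy hz hz σ

/-- A form of the Pieri rule. The weights `P.card` and `K.card` are those that eliminate the unknown
average containing the transposition `(x z)`. -/
theorem classAverage_hookSymmetrizer_recursion {P K : Finset α} {x z : α} (hPK : Disjoint P K)
    (hx : x ∈ P) (hz : z ∈ K) (σ : Perm α) :
    (P.card : ℚ) * classAverage σ (hookSymmetrizer P K x) +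
      (K.card : ℚ) * classAverage σ (hookSymmetrizer (insert z P) (K.erase z) z)
      = ((P.card + K.card : ℕ) : ℚ) * classAverage σ (symmetrizer P * antisymmetrizer K) := by
  rw [classAverage_hookSymmetrizer hPK hx hz, classAverage_hookSymmetrizer_insert hPK hx hz]
  push_cast
  ring

end Hook

end Hurwitz

end

noncomputable section

namespace Hurwitz

open Equiv MonoidAlgebra

/-! ### Invariant subsets of a permutation -/

section Invariant

variable {α : Type*} [DecidableEq α]

/-- The permutation agreeing with `σ` on `B` and trivial elsewhere (trivial if `B` is not
invariant under `σ`). -/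
def restrictPerm (σ : Perm α) (B : Finset α) : Perm α :=
  open Classical in
  if h : ∀ a, σ a ∈ B ↔ a ∈ B then Perm.ofSubtype (σ.subtypePerm h) else 1

theorem restrictPerm_apply {σ : Perm α} {B : Finset α} (h : ∀ a, σ a ∈ B ↔ a ∈ B) (a : α) :
    restrictPerm σ B a = if a ∈ B then σ a else a := by
  rw [restrictPerm, dif_pos h]
  split_ifs with ha
  · rw [Perm.ofSubtype_apply_of_mem _ ha]
    rfl
  · rw [Perm.ofSubtype_apply_of_not_mem _ ha]

theorem restrictPerm_mem_permsOn (σ : Perm α) (B : Finset α) : restrictPerm σ B ∈ permsOn B := by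
  intro a ha
  rw [restrictPerm]
  split_ifs with h
  · rw [Perm.ofSubtype_apply_of_not_mem _ ha]
  · rfl

variable [Fintype α]

open Classical in
/-- The sign of the restriction of a permutation to an invariant set, zero for other sets. -/
def restrictSign (σ : Perm α) (B : Finset α) : ℚ :=
  if ∀ a, σ a ∈ B ↔ a ∈ B then signValue Perm.sign (restrictPerm σ B) else 0

/-- A permutation preserving `K` factors uniquely into one supported on the complement and one
supported on `K`; only the latter carries a sign. -/
theorem symmetrizer_compl_mul_antisymmetrizer (K : Finset α) :
    symmetrizer Kᶜ * antisymmetrizer K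
      = ∑ σ : Perm α, restrictSign σ K • of ℚ (Perm α) σ := by
  classical
  simp only [restrictSign, ite_smul, zero_smul]
  rw [← Finset.sum_filter, symmetrizer, antisymmetrizer, twistedSum, twistedSum,
    Finset.sum_mul_sum, ← Finset.sum_product']
  have hprod : ∀ {r s : Perm α}, r ∈ permsOn Kᶜ → s ∈ permsOn K →
      ∀ a, (r * s) a = if a ∈ K then s a else r a := by
    intro r s hr hs a
    rw [Perm.mul_apply]
    split_ifs with ha
    · exact hr _ (by simpa using (apply_mem_iff_of_mem_permsOn hs a).2 ha)
    · rw [hs a ha]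
  have hinv : ∀ {r s : Perm α}, r ∈ permsOn Kᶜ → s ∈ permsOn K →
      ∀ a, (r * s) a ∈ K ↔ a ∈ K := by
    intro r s hr hs a
    rw [hprod hr hs]
    split_ifs with ha
    · exact apply_mem_iff_of_mem_permsOn hs a
    · simpa using (apply_mem_iff_of_mem_permsOn hr a).not
  have hres : ∀ {r s : Perm α}, r ∈ permsOn Kᶜ → s ∈ permsOn K → restrictPerm (r * s) K = s := by
    intro r s hr hs
    ext a
    rw [restrictPerm_apply (hinv hr hs), hprod hr hs]
    split_ifs with ha
    · rfl
    · exact (hs a ha).symm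
  refine Finset.sum_bij' (fun p _ => p.1 * p.2) (fun σ _ => (restrictPerm σ Kᶜ, restrictPerm σ K))
    ?_ ?_ ?_ ?_ ?_
  · rintro ⟨r, s⟩ hp
    simp only [Finset.mem_product, Finset.mem_filter, Finset.mem_univ, true_and] at hp ⊢
    exact hinv hp.1 hp.2
  · intro σ _
    simp only [Finset.mem_product, Finset.mem_filter, Finset.mem_univ, true_and]
    exact ⟨restrictPerm_mem_permsOn σ _, restrictPerm_mem_permsOn σ _⟩
  · rintro ⟨r, s⟩ hp
    simp only [Finset.mem_product, Finset.mem_filter, Finset.mem_univ, true_and] at hp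
    have hinv' : ∀ a, (r * s) a ∈ Kᶜ ↔ a ∈ Kᶜ := by
      intro a
      rw [Finset.mem_compl, Finset.mem_compl, hinv hp.1 hp.2]
    simp only [Prod.mk.injEq]
    refine ⟨?_, hres hp.1 hp.2⟩
    ext a
    rw [restrictPerm_apply hinv', hprod hp.1 hp.2]
    by_cases ha : a ∈ K
    · simpa [ha] using (hp.1 a (by simpa using ha)).symm
    · simp [ha]
  · intro σ hσ
    simp only [Finset.mem_filter, Finset.mem_univ, true_and] at hσ
    have hσ' : ∀ a, σ a ∈ Kᶜ ↔ a ∈ Kᶜ := by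
      intro a
      rw [Finset.mem_compl, Finset.mem_compl, hσ]
    ext a
    rw [hprod (restrictPerm_mem_permsOn σ _) (restrictPerm_mem_permsOn σ _),
      restrictPerm_apply hσ, restrictPerm_apply hσ']
    by_cases ha : a ∈ K <;> simp [ha]
  · rintro ⟨r, s⟩ hp
    simp only [Finset.mem_product, Finset.mem_filter, Finset.mem_univ, true_and] at hp
    rw [hres hp.1 hp.2, smul_mul_smul_comm, ← map_mul]
    simp [signValue]

theorem coeff_symmetrizer_compl_mul_antisymmetrizer (K : Finset α) (σ : Perm α) :
    (symmetrizer Kᶜ * antisymmetrizer K).coeff σ = restrictSign σ K := by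
  classical
  rw [symmetrizer_compl_mul_antisymmetrizer, coeff_sum, Finset.sum_apply']
  simp [of_apply, Finsupp.single_apply]

theorem restrictSign_conj (σ τ : Perm α) (K : Finset α) :
    restrictSign (τ⁻¹ * σ * τ) K = restrictSign σ (K.map τ.toEmbedding) := by
  have hmem : ∀ a, a ∈ K.map τ.toEmbedding ↔ τ⁻¹ a ∈ K := by
    intro a
    rw [Finset.mem_map_equiv]
    rfl
  have h : (∀ a, (τ⁻¹ * σ * τ) a ∈ K ↔ a ∈ K) ↔
      ∀ a, σ a ∈ K.map τ.toEmbedding ↔ a ∈ K.map τ.toEmbedding := by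
    simp only [hmem]
    constructor
    · intro h a
      simpa using h (τ⁻¹ a)
    · intro h a
      simpa using h (τ a)
  rw [restrictSign, restrictSign]
  by_cases h1 : ∀ a, (τ⁻¹ * σ * τ) a ∈ K ↔ a ∈ K
  · have h2 := h.1 h1
    rw [if_pos h1, if_pos h2]
    have h3 : restrictPerm (τ⁻¹ * σ * τ) K = τ⁻¹ * restrictPerm σ (K.map τ.toEmbedding) * τ := by
      ext a
      have h4 : (τ⁻¹ * restrictPerm σ (K.map τ.toEmbedding) * τ) a
          = τ⁻¹ (restrictPerm σ (K.map τ.toEmbedding) (τ a)) := rfl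
      have h5 : τ a ∈ K.map τ.toEmbedding ↔ a ∈ K := by
        rw [hmem]
        simp
      rw [restrictPerm_apply h1, h4, restrictPerm_apply h2]
      by_cases ha : a ∈ K
      · rw [if_pos ha, if_pos (h5.2 ha)]
        rfl
      · rw [if_neg ha, if_neg (fun h6 => ha (h5.1 h6))]
        simp
    rw [h3, signValue_mul, signValue_mul, mul_right_comm, ← signValue_mul, inv_mul_cancel,
      signValue_one, one_mul]
  · rw [if_neg h1, if_neg (fun h2 => h1 (h.2 h2))]

/-- The fibres of `τ ↦ τ(K)` over the subsets of size `K.card` are translates of one another, so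
each has `d!` divided by a binomial coefficient as its size. -/
theorem card_filter_map_eq {K B : Finset α} (h : B.card = K.card) :
    (Finset.univ.filter fun τ : Perm α => K.map τ.toEmbedding = B).card
      = K.card.factorial * Kᶜ.card.factorial := by
  have key : ∀ B ∈ Finset.powersetCard K.card (Finset.univ : Finset α),
      (Finset.univ.filter fun τ : Perm α => K.map τ.toEmbedding = B).card
        = (Finset.univ.filter fun τ : Perm α => K.map τ.toEmbedding = K).card := by
    intro B hB
    have hcard : Fintype.card {a // a ∈ K} = Fintype.card {a // a ∈ B} := by
      rw [Fintype.card_coe, Fintype.card_coe, (Finset.mem_powersetCard.1 hB).2]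
    obtain ⟨e⟩ := Fintype.card_eq.1 hcard
    have hρ : K.map (e.extendSubtype).toEmbedding = B := by
      ext b
      rw [Finset.mem_map_equiv]
      constructor
      · intro hb
        have := e.extendSubtype_mem _ hb
        simpa using this
      · intro hb
        by_contra hb'
        have := e.extendSubtype_not_mem _ hb'
        simp [hb] at this
    set ρ := e.extendSubtype with hρdef
    refine Finset.card_bij' (fun τ _ => ρ⁻¹ * τ) (fun τ _ => ρ * τ) ?_ ?_ ?_ ?_
    · intro τ hτ
      simp only [Finset.mem_filter, Finset.mem_univ, true_and] at hτ ⊢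
      rw [← hρ] at hτ
      ext a
      have := Finset.ext_iff.1 hτ (ρ a)
      rw [Finset.mem_map_equiv, Finset.mem_map_equiv] at this
      rw [Finset.mem_map_equiv]
      change τ.symm (ρ a) ∈ K ↔ a ∈ K
      rw [this, symm_apply_apply]
    · intro τ hτ
      simp only [Finset.mem_filter, Finset.mem_univ, true_and] at hτ ⊢
      rw [← hρ]
      ext a
      have := Finset.ext_iff.1 hτ (ρ⁻¹ a)
      rw [Finset.mem_map_equiv] at this
      rw [Finset.mem_map_equiv, Finset.mem_map_equiv]
      simpa [Perm.mul_def] using this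
    · simp
    · simp
  have htotal : ∑ B ∈ Finset.powersetCard K.card (Finset.univ : Finset α),
      (Finset.univ.filter fun τ : Perm α => K.map τ.toEmbedding = B).card
        = (Fintype.card α).factorial := by
    rw [← Finset.card_eq_sum_card_fiberwise, Finset.card_univ, Fintype.card_perm]
    intro τ _
    simp
  rw [Finset.sum_congr rfl key, Finset.sum_const, Finset.card_powersetCard, Finset.card_univ,
    smul_eq_mul, ← Nat.choose_mul_factorial_mul_factorial (Finset.card_le_univ K),
    mul_assoc] at htotal
  rw [key B (by simp [h]), Finset.card_compl]
  exact Nat.eq_of_mul_eq_mul_left (Nat.choose_pos (Finset.card_le_univ K)) htotal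

/-- Conjugation carries `K` to every subset of the same size equally often. Up to the factorials
this is the character induced from trivial ⊠ sign. -/
theorem classAverage_symmetrizer_compl_mul_antisymmetrizer (K : Finset α) (σ : Perm α) :
    classAverage σ (symmetrizer Kᶜ * antisymmetrizer K)
      = (K.card.factorial : ℚ) * (Kᶜ.card.factorial : ℚ) *
        ∑ B ∈ Finset.powersetCard K.card Finset.univ, restrictSign σ B := by
  rw [classAverage_apply]
  simp only [coeff_symmetrizer_compl_mul_antisymmetrizer, restrictSign_conj]
  rw [← Finset.sum_fiberwise_of_maps_to (s := Finset.univ)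
    (t := Finset.powersetCard K.card Finset.univ) (g := fun τ : Perm α => K.map τ.toEmbedding)
    (by simp), Finset.mul_sum]
  refine Finset.sum_congr rfl fun B hB => ?_
  rw [Finset.sum_congr rfl (g := fun _ => restrictSign σ B)]
  · rw [Finset.sum_const, card_filter_map_eq (Finset.mem_powersetCard.1 hB).2, nsmul_eq_mul]
    push_cast
    ring
  · intro τ hτ
    rw [(Finset.mem_filter.1 hτ).2]

end Invariant

/-! ### The generating function of signs over invariant subsets -/

section Orbits

open Polynomial

variable {α : Type*} [DecidableEq α] [Fintype α]

open Classical in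
/-- The orbit of a point under a permutation. -/
def cycleSet (σ : Perm α) (a : α) : Finset α := Finset.univ.filter fun b => σ.SameCycle a b

theorem mem_cycleSet {σ : Perm α} {a b : α} : b ∈ cycleSet σ a ↔ σ.SameCycle a b := by
  simp [cycleSet]

theorem cycleSet_eq_of_mem {σ : Perm α} {a b : α} (h : b ∈ cycleSet σ a) :
    cycleSet σ b = cycleSet σ a := by
  ext c
  rw [mem_cycleSet] at h
  rw [mem_cycleSet, mem_cycleSet]
  exact ⟨fun h' => h.trans h', fun h' => h.symm.trans h'⟩

/-- The orbits of a permutation. -/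
def cycleSets (σ : Perm α) : Finset (Finset α) := Finset.univ.image (cycleSet σ)

theorem cycleSet_invariant (σ : Perm α) (a b : α) : σ b ∈ cycleSet σ a ↔ b ∈ cycleSet σ a := by
  rw [mem_cycleSet, mem_cycleSet, Perm.sameCycle_apply_right]

theorem cycleSet_subset_of_invariant {σ : Perm α} {B : Finset α} (h : ∀ a, σ a ∈ B ↔ a ∈ B)
    {a : α} (ha : a ∈ B) : cycleSet σ a ⊆ B := by
  intro b hb
  obtain ⟨i, rfl⟩ := (mem_cycleSet.1 hb).exists_nat_pow_eq
  induction i with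
  | zero => simpa using ha
  | succ i ih =>
    rw [pow_succ', Perm.mul_apply, h]
    exact ih (by simp [mem_cycleSet, Perm.SameCycle.refl])

theorem pairwiseDisjoint_cycleSets (σ : Perm α) :
    ((cycleSets σ : Finset (Finset α)) : Set (Finset α)).PairwiseDisjoint id := by
  intro o ho o' ho' hne
  obtain ⟨a, -, rfl⟩ := Finset.mem_image.1 ho
  obtain ⟨b, -, rfl⟩ := Finset.mem_image.1 ho'
  refine Finset.disjoint_left.2 fun c hc hc' => hne ?_
  rw [← cycleSet_eq_of_mem hc, ← cycleSet_eq_of_mem hc']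

/-- Orbits are the supports of the cycle factors together with the singletons of fixed points, just
as `partition` pads the cycle type with ones. -/
theorem prod_cycleSets {M : Type*} [CommMonoid M] (σ : Perm α) (f : ℕ → M) :
    ∏ o ∈ cycleSets σ, f o.card = (σ.partition.parts.map f).prod := by
  have hsupp : ∀ a, σ a ≠ a → (σ.cycleOf a).support = cycleSet σ a := by
    intro a ha
    ext b
    rw [Perm.mem_support_cycleOf_iff' ha, mem_cycleSet]
  have hfix : ∀ a, σ a = a → cycleSet σ a = {a} := by
    intro a ha
    refine Finset.Subset.antisymm ?_ (by simp [mem_cycleSet, Perm.SameCycle.refl])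
    refine cycleSet_subset_of_invariant (fun b => ?_) (Finset.mem_singleton_self a)
    rw [Finset.mem_singleton, Finset.mem_singleton]
    constructor
    · intro h; exact σ.injective (h.trans ha.symm)
    · rintro rfl; exact ha
  have hunion : cycleSets σ = σ.cycleFactorsFinset.image Perm.support ∪
      (σ.supportᶜ).image (fun a => ({a} : Finset α)) := by
    ext o
    simp only [cycleSets, Finset.mem_image, Finset.mem_univ, true_and, Finset.mem_union,
      Finset.mem_compl, Perm.mem_support, not_not]
    constructor
    · rintro ⟨a, rfl⟩
      by_cases ha : σ a = a
      · exact Or.inr ⟨a, ha, (hfix a ha).symm⟩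
      · exact Or.inl ⟨σ.cycleOf a, Perm.cycleOf_mem_cycleFactorsFinset_iff.2
          (Perm.mem_support.2 ha), hsupp a ha⟩
    · rintro (⟨c, hc, rfl⟩ | ⟨a, ha, rfl⟩)
      · obtain ⟨a, ha⟩ := (Perm.mem_cycleFactorsFinset_iff.1 hc).1.nonempty_support
        have h1 := Perm.cycle_is_cycleOf ha hc
        have h2 := Perm.mem_support.1 (Perm.mem_cycleFactorsFinset_support_le hc ha)
        exact ⟨a, by rw [h1, hsupp a h2]⟩
      · exact ⟨a, hfix a ha⟩
  have hdisj : Disjoint (σ.cycleFactorsFinset.image Perm.support)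
      ((σ.supportᶜ).image (fun a => ({a} : Finset α))) := by
    rw [Finset.disjoint_left]
    intro o ho ho'
    obtain ⟨c, hc, rfl⟩ := Finset.mem_image.1 ho
    obtain ⟨a, ha, h⟩ := Finset.mem_image.1 ho'
    have h1 := (Perm.mem_cycleFactorsFinset_iff.1 hc).1.two_le_card_support
    rw [← h, Finset.card_singleton] at h1
    omega
  rw [hunion, Finset.prod_union hdisj, Finset.prod_image, Finset.prod_image, Perm.parts_partition,
    Multiset.map_add, Multiset.prod_add, Perm.cycleType_def, Multiset.map_map,
    Multiset.map_replicate, Multiset.prod_replicate, ← Finset.card_compl]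
  · congr 1
    simp
  · intro a _ b _ h
    simpa using h
  · intro c hc c' hc' h
    obtain ⟨a, ha⟩ := (Perm.mem_cycleFactorsFinset_iff.1 hc).1.nonempty_support
    have ha' : a ∈ c'.support := by
      rw [← h]
      exact ha
    rw [Perm.cycle_is_cycleOf ha hc, Perm.cycle_is_cycleOf ha' hc']

/-- The contribution of a finite set to the signed generating function of invariant subsets. -/
def invariantTerm (σ : Perm α) (B : Finset α) : ℚ[X] :=
  C ((-1) ^ B.card * restrictSign σ B) * X ^ B.card

theorem invariantTerm_union {σ : Perm α} {B B' : Finset α} (hB : ∀ a, σ a ∈ B ↔ a ∈ B)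
    (hB' : ∀ a, σ a ∈ B' ↔ a ∈ B') (h : Disjoint B B') :
    invariantTerm σ (B ∪ B') = invariantTerm σ B * invariantTerm σ B' := by
  have hU : ∀ a, σ a ∈ B ∪ B' ↔ a ∈ B ∪ B' := by
    intro a
    rw [Finset.mem_union, Finset.mem_union, hB, hB']
  have h1 : restrictPerm σ (B ∪ B') = restrictPerm σ B * restrictPerm σ B' := by
    ext a
    rw [Perm.mul_apply, restrictPerm_apply hU, restrictPerm_apply hB', restrictPerm_apply hB]
    by_cases ha' : a ∈ B'
    · have h2 : σ a ∉ B := fun h3 => Finset.disjoint_left.1 h ((hB a).1 h3) ha'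
      simp [ha', h2]
    · simp [ha']
  rw [invariantTerm, invariantTerm, invariantTerm, restrictSign, restrictSign, restrictSign,
    if_pos hU, if_pos hB, if_pos hB', h1, signValue_mul, Finset.card_union_of_disjoint h, pow_add,
    pow_add]
  simp only [C_mul]
  ring

/-- A cycle of length `m` has sign `(-1)^(m-1)`, so the factor `(-1)^m` in `invariantTerm` leaves
`-1` whatever the length. -/
theorem invariantTerm_cycleSet (σ : Perm α) (a : α) :
    invariantTerm σ (cycleSet σ a) = -X ^ (cycleSet σ a).card := by
  have hinv := cycleSet_invariant σ a
  have h1 : restrictPerm σ (cycleSet σ a) = σ.cycleOf a := by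
    ext b
    rw [restrictPerm_apply hinv, Perm.cycleOf_apply]
    simp only [mem_cycleSet]
  have h2 : (-1 : ℚ) ^ (cycleSet σ a).card * signValue Perm.sign (σ.cycleOf a) = -1 := by
    by_cases ha : σ a = a
    · have h3 : (cycleSet σ a).card = 1 := by
        rw [Finset.card_eq_one]
        refine ⟨a, Finset.Subset.antisymm (cycleSet_subset_of_invariant (fun b => ?_)
          (Finset.mem_singleton_self a)) (by simp [mem_cycleSet, Perm.SameCycle.refl])⟩
        rw [Finset.mem_singleton, Finset.mem_singleton]
        exact ⟨fun h => σ.injective (h.trans ha.symm), by rintro rfl; exact ha⟩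
      rw [h3, (Perm.cycleOf_eq_one_iff σ).2 ha, signValue_one]
      norm_num
    · have h3 : (σ.cycleOf a).support = cycleSet σ a := by
        ext b
        rw [Perm.mem_support_cycleOf_iff' ha, mem_cycleSet]
      rw [signValue, (Perm.isCycle_cycleOf σ ha).sign, h3]
      push_cast
      rw [mul_neg, ← mul_pow]
      norm_num
  rw [invariantTerm, restrictSign, if_pos hinv, h1, h2]
  simp

/-- Invariant subsets are exactly the unions of orbits and `invariantTerm` is multiplicative on
disjoint ones, so the sum is the expanded product over orbits. -/
theorem sum_invariantTerm (σ : Perm α) :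
    ∑ B : Finset α, invariantTerm σ B = (σ.partition.parts.map fun m => 1 - (X : ℚ[X]) ^ m).prod := by
  classical
  rw [← prod_cycleSets σ fun m => 1 - (X : ℚ[X]) ^ m]
  simp only [sub_eq_add_neg]
  rw [Finset.prod_one_add]
  have hzero : ∀ B : Finset α, ¬ (∀ a, σ a ∈ B ↔ a ∈ B) → invariantTerm σ B = 0 := by
    intro B hB
    rw [invariantTerm, restrictSign, if_neg hB]
    simp
  rw [← Finset.sum_filter_of_ne (p := fun B => ∀ a, σ a ∈ B ↔ a ∈ B)
    (fun B _ h => by_contra fun h' => h (hzero B h'))]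
  symm
  have hinv : ∀ T ⊆ cycleSets σ, ∀ a, σ a ∈ T.biUnion id ↔ a ∈ T.biUnion id := by
    intro T hT a
    simp only [Finset.mem_biUnion, id]
    refine exists_congr fun o => and_congr_right fun ho => ?_
    obtain ⟨b, -, rfl⟩ := Finset.mem_image.1 (hT ho)
    exact cycleSet_invariant σ b a
  refine Finset.sum_bij' (fun T _ => T.biUnion id) (fun B _ => (cycleSets σ).filter (· ⊆ B))
    ?_ ?_ ?_ ?_ ?_
  · intro T hT
    simpa using hinv T (Finset.mem_powerset.1 hT)
  · intro B _
    simp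
  · intro T hT
    have hT' := Finset.mem_powerset.1 hT
    ext o
    rw [Finset.mem_filter]
    constructor
    · rintro ⟨ho, hsub⟩
      obtain ⟨a, -, rfl⟩ := Finset.mem_image.1 ho
      have ha := hsub (mem_cycleSet.2 (Perm.SameCycle.refl σ a))
      obtain ⟨o', ho', ha'⟩ := Finset.mem_biUnion.1 ha
      obtain ⟨b, -, rfl⟩ := Finset.mem_image.1 (hT' ho')
      rwa [cycleSet_eq_of_mem ha']
    · exact fun ho => ⟨hT' ho, Finset.subset_biUnion_of_mem id ho⟩
  · intro B hB
    have hB' : ∀ a, σ a ∈ B ↔ a ∈ B := by simpa using hB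
    ext a
    simp only [Finset.mem_biUnion, Finset.mem_filter, id]
    constructor
    · rintro ⟨o, ⟨-, ho⟩, ha⟩
      exact ho ha
    · intro ha
      exact ⟨cycleSet σ a, ⟨Finset.mem_image_of_mem _ (Finset.mem_univ a),
        cycleSet_subset_of_invariant hB' ha⟩, mem_cycleSet.2 (Perm.SameCycle.refl σ a)⟩
  · intro T hT
    have hT' := Finset.mem_powerset.1 hT
    clear hT
    induction T using Finset.induction_on with
    | empty =>
      rw [Finset.prod_empty, Finset.biUnion_empty, invariantTerm, restrictSign, if_pos (by simp)]
      have h1 : restrictPerm σ ∅ = 1 := by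
        ext a
        rw [restrictPerm_apply (by simp)]
        simp
      rw [h1, signValue_one]
      simp
    | insert o T ho ih =>
      have hT := (Finset.insert_subset_iff.1 hT').2
      have hoc := (Finset.insert_subset_iff.1 hT').1
      obtain ⟨a, -, rfl⟩ := Finset.mem_image.1 hoc
      rw [Finset.prod_insert ho, ih hT, Finset.biUnion_insert, id, invariantTerm_union
        (cycleSet_invariant σ a) (hinv T hT), invariantTerm_cycleSet]
      rw [Finset.disjoint_biUnion_right]
      intro o' ho'
      exact pairwiseDisjoint_cycleSets σ hoc (hT ho') (by rintro rfl; exact ho ho')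

theorem coeff_prod_one_sub_pow (σ : Perm α) (k : ℕ) :
    ((σ.partition.parts.map fun m => 1 - (X : ℚ[X]) ^ m).prod).coeff k
      = (-1) ^ k * ∑ B ∈ Finset.powersetCard k Finset.univ, restrictSign σ B := by
  rw [← sum_invariantTerm, finsetSum_coeff, Finset.powersetCard_eq_filter, Finset.powerset_univ,
    Finset.sum_filter, Finset.mul_sum]
  refine Finset.sum_congr rfl fun B _ => ?_
  rw [invariantTerm, coeff_C_mul_X_pow]
  by_cases h : B.card = k
  · simp [h]
  · simp [h, Ne.symm h]

end Orbits

end Hurwitz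

end

noncomputable section

namespace Hurwitz

open Equiv MonoidAlgebra

/-! ### The characters of hooks -/

section HookCharacter

open Polynomial

/-- The polynomial `∏ (1 - X ^ m) / (1 - X)`, the product running over a multiset. -/
def hookPoly (s : Multiset ℕ) : ℚ[X] := (s.map fun m => 1 - (X : ℚ[X]) ^ m).prod / (1 - X)

theorem one_sub_X_ne_zero : (1 - X : ℚ[X]) ≠ 0 := by
  intro h
  have := congrArg (eval 0) h
  simp at this

theorem hookPoly_cons (m : ℕ) (t : Multiset ℕ) :
    hookPoly (m ::ₘ t) =
      (∑ i ∈ Finset.range m, X ^ i) * (t.map fun m => 1 - (X : ℚ[X]) ^ m).prod := by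
  rw [hookPoly, Multiset.map_cons, Multiset.prod_cons, ← mul_neg_geom_sum (X : ℚ[X]) m, mul_assoc,
    mul_div_cancel_left₀ _ one_sub_X_ne_zero]

theorem one_sub_X_mul_hookPoly {s : Multiset ℕ} (hs : s ≠ 0) :
    (1 - X) * hookPoly s = (s.map fun m => 1 - (X : ℚ[X]) ^ m).prod := by
  obtain ⟨m, hm⟩ := Multiset.exists_mem_of_ne_zero hs
  obtain ⟨t, rfl⟩ := Multiset.exists_cons_of_mem hm
  rw [hookPoly_cons, ← mul_assoc, mul_neg_geom_sum, Multiset.map_cons, Multiset.prod_cons]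

theorem natDegree_hookPoly_lt {s : Multiset ℕ} (hs : s ≠ 0) (hpos : ∀ m ∈ s, 0 < m) :
    (hookPoly s).natDegree < s.sum := by
  obtain ⟨m, hm⟩ := Multiset.exists_mem_of_ne_zero hs
  obtain ⟨t, rfl⟩ := Multiset.exists_cons_of_mem hm
  have h0 : ∀ k : ℕ, (1 - (X : ℚ[X]) ^ k).natDegree ≤ k := by
    intro k
    refine (natDegree_sub_le _ _).trans ?_
    simp
  have h1 : ((t.map fun m => 1 - (X : ℚ[X]) ^ m).prod).natDegree ≤ t.sum := by
    clear hm hs hpos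
    induction t using Multiset.induction_on with
    | empty => simp
    | cons a t ih =>
      rw [Multiset.map_cons, Multiset.prod_cons, Multiset.sum_cons]
      exact natDegree_mul_le.trans (add_le_add (h0 a) ih)
  have h2 : (∑ i ∈ Finset.range m, (X : ℚ[X]) ^ i).natDegree ≤ m - 1 := by
    refine natDegree_sum_le_of_forall_le _ _ fun i hi => ?_
    rw [natDegree_X_pow]
    have := Finset.mem_range.1 hi
    omega
  have hm' : 0 < m := hpos m (Multiset.mem_cons_self m t)
  rw [hookPoly_cons, Multiset.sum_cons]
  have := natDegree_mul_le.trans (add_le_add h2 h1)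
  omega

/-- Each part beyond the first contributes a factor `1 - X ^ a`, zero at `1`. This is what singles
out long cycles. -/
theorem eval_one_hookPoly_cons (m : ℕ) (t : Multiset ℕ) :
    (hookPoly (m ::ₘ t)).eval 1 = if t = 0 then (m : ℚ) else 0 := by
  rw [hookPoly_cons, eval_mul, eval_finsetSum]
  split_ifs with h
  · simp [h]
  · obtain ⟨a, ha⟩ := Multiset.exists_mem_of_ne_zero h
    obtain ⟨u, rfl⟩ := Multiset.exists_cons_of_mem ha
    simp

theorem coeff_hookPoly_singleton {d k : ℕ} (hk : k < d) : (hookPoly {d}).coeff k = 1 := by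
  have h : hookPoly {d} = ∑ i ∈ Finset.range d, X ^ i := by
    have := hookPoly_cons d 0
    simpa using this
  rw [h, finsetSum_coeff]
  simp [coeff_X_pow, hk]

variable {α : Type*} [DecidableEq α] [Fintype α]

theorem partition_parts_ne_zero [Nonempty α] (σ : Perm α) : σ.partition.parts ≠ 0 := by
  intro h
  have h1 := σ.partition.parts_sum
  rw [h, Multiset.sum_zero] at h1
  exact Fintype.card_ne_zero h1.symm

theorem partition_parts_inv (σ : Perm α) : σ⁻¹.partition.parts = σ.partition.parts := by
  rw [Perm.parts_partition, Perm.parts_partition, Perm.cycleType_inv, Perm.support_inv]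

/-- Induction on `K.card`: the recursion for neighbouring hooks is matched with the fact that the
coefficients of `(1 - X) R` are the differences `R_k - R_{k-1}`. -/
theorem classAverage_hookSymmetrizer_eq (σ : Perm α) (K : Finset α) (x : α) (hx : x ∉ K) :
    classAverage σ (hookSymmetrizer Kᶜ K x)
      = (K.card.factorial : ℚ) * ((Kᶜ.card - 1).factorial : ℚ) * (Fintype.card α : ℚ) *
        ((-1) ^ K.card * (hookPoly σ.partition.parts).coeff K.card) := by
  have : Nonempty α := ⟨x⟩
  have hu : ∀ B : Finset α, classAverage σ (symmetrizer Bᶜ * antisymmetrizer B)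
      = (B.card.factorial : ℚ) * (Bᶜ.card.factorial : ℚ) *
        ((-1) ^ B.card * ((1 - X) * hookPoly σ.partition.parts).coeff B.card) := by
    intro B
    rw [classAverage_symmetrizer_compl_mul_antisymmetrizer,
      one_sub_X_mul_hookPoly (partition_parts_ne_zero σ), coeff_prod_one_sub_pow,
      ← mul_assoc ((-1 : ℚ) ^ B.card), ← mul_pow]
    norm_num
  have hpos : ∀ {B : Finset α} {y : α}, y ∉ B → (Bᶜ.card.factorial : ℚ)
      = (Bᶜ.card : ℚ) * ((Bᶜ.card - 1).factorial : ℚ) := by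
    intro B y hy
    have h1 : Bᶜ.card ≠ 0 := Finset.card_ne_zero_of_mem (Finset.mem_compl.2 hy)
    rw [← Nat.mul_factorial_pred h1]
    push_cast
    rfl
  induction hk : K.card generalizing K x with
  | zero =>
    obtain rfl := Finset.card_eq_zero.1 hk
    have h1 : hookSymmetrizer (∅ᶜ : Finset α) ∅ x
        = symmetrizer ∅ᶜ * antisymmetrizer (∅ : Finset α) := by
      rw [hookSymmetrizer, antisymmetrizer_insert hx]
      simp [starSum]
    rw [h1, hu, hpos hx]
    simp only [Finset.card_empty, Finset.compl_empty, Finset.card_univ, mul_coeff_zero,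
      Polynomial.coeff_sub, coeff_one_zero, coeff_X_zero]
    ring
  | succ k ih =>
    have hne : K.Nonempty := Finset.card_pos.1 (by omega)
    obtain ⟨z, hz⟩ := hne
    have hcE : (K.erase z).card = k := by rw [Finset.card_erase_of_mem hz, hk]; rfl
    have hcompl : insert z Kᶜ = (K.erase z)ᶜ := by rw [Finset.compl_erase]
    have hzP : z ∉ Kᶜ := by simpa using hz
    have hcard : (K.erase z)ᶜ.card - 1 = Kᶜ.card := by
      rw [← hcompl, Finset.card_insert_of_notMem hzP]
      rfl
    have h1 := classAverage_hookSymmetrizer_recursion (P := Kᶜ) (K := K) (x := x) (z := z)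
      disjoint_compl_left (Finset.mem_compl.2 hx) hz σ
    rw [hcompl, ih (K.erase z) z (Finset.notMem_erase z K) hcE, hu, Finset.card_compl_add_card,
      hcard, hk, hpos hx, sub_mul, one_mul, Polynomial.coeff_sub, coeff_X_mul, Nat.factorial_succ] at h1
    have hp : (Kᶜ.card : ℚ) ≠ 0 :=
      Nat.cast_ne_zero.2 (Finset.card_ne_zero_of_mem (Finset.mem_compl.2 hx))
    refine mul_left_cancel₀ hp ?_
    rw [Nat.factorial_succ]
    push_cast at h1 ⊢
    linear_combination h1

theorem character_hookSymmetrizer (σ : Perm α) (K : Finset α) (x : α) (hx : x ∉ K) :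
    (leftIdealRep (hookSymmetrizer Kᶜ K x)).character σ
      = (-1) ^ K.card * (hookPoly σ.partition.parts).coeff K.card := by
  have hsq := hookSymmetrizer_mul_self (P := Kᶜ) (K := K) (x := x) disjoint_compl_left
    (Finset.mem_compl.2 hx)
  rw [Finset.card_compl_add_card] at hsq
  have hd : (Fintype.card α : ℚ) ≠ 0 := by
    have : Nonempty α := ⟨x⟩
    exact Nat.cast_ne_zero.2 Fintype.card_ne_zero
  have hh : (K.card.factorial : ℚ) * ((Kᶜ.card - 1).factorial : ℚ) * (Fintype.card α : ℚ) ≠ 0 :=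
    mul_ne_zero (mul_ne_zero (Nat.cast_ne_zero.2 (Nat.factorial_ne_zero _))
      (Nat.cast_ne_zero.2 (Nat.factorial_ne_zero _))) hd
  rw [character_leftIdealRep hh hsq, classAverage_hookSymmetrizer_eq _ _ _ hx, partition_parts_inv,
    mul_div_cancel_left₀ _ hh]

end HookCharacter

/-! ### Vanishing of non-hook characters on long cycles -/

section Vanishing

variable {α : Type*}

/-- The subgroup of permutations preserving a labelling of the points. -/
def labelSubgroup {ι : Type*} (f : α → ι) : Subgroup (Perm α) where
  carrier := {σ | ∀ a, f (σ a) = f a}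
  one_mem' := by simp
  mul_mem' := by
    intro σ τ hσ hτ a
    rw [Perm.mul_apply, hσ, hτ]
  inv_mem' := by
    intro σ hσ a
    rw [← hσ (σ⁻¹ a)]
    simp

theorem swap_mem_labelSubgroup [DecidableEq α] {ι : Type*} {f : α → ι} {x y : α} (h : f x = f y) :
    swap x y ∈ labelSubgroup f := by
  intro a
  rw [swap_apply_def]
  split_ifs with h1 h2
  · rw [h1, h]
  · rw [h2, h]
  · rfl

theorem signValue_trivial (σ : Perm α) : signValue (1 : Perm α →* ℤˣ) σ = 1 := by simp [signValue]

variable [DecidableEq α] [Fintype α]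

/-- By pigeonhole two points `y`, `z` of `S` have preimages under `τ` with the same label. The
transposition `(y z)` is then absorbed on the left with `ε` and, conjugated through `τ`, on the
right with `ε'`; the signs are opposite. -/
theorem twistedSum_mul_of_mul_twistedSum_eq_zero {ε ε' : Perm α →* ℤˣ}
    (hε : ∀ x y : α, x ≠ y → signValue ε (swap x y) = -signValue ε' (swap x y))
    {f : α → ℕ} {S : Finset α} (hS : (Finset.univ.image f).card < S.card) (τ : Perm α) :
    twistedSum ε (permsOn S) * of ℚ (Perm α) τ * twistedSum ε' (labelSubgroup f) = 0 := by
  obtain ⟨y, hy, z, hz, hne, hyz⟩ := Finset.exists_ne_map_eq_of_card_lt_of_maps_to hS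
    (f := fun a => f (τ⁻¹ a)) (fun a _ => Finset.mem_image_of_mem f (Finset.mem_univ _))
  set u := twistedSum ε (permsOn S) * of ℚ (Perm α) τ * twistedSum ε' (labelSubgroup f) with hu
  have h1 : twistedSum ε (permsOn S) * of ℚ (Perm α) (swap y z) * of ℚ (Perm α) τ *
      twistedSum ε' (labelSubgroup f) = signValue ε (swap y z) • u := by
    rw [twistedSum_mul_of ε (swap_mem_permsOn hy hz), smul_mul_assoc, smul_mul_assoc]
  have h2 : swap y z * τ = τ * swap (τ⁻¹ y) (τ⁻¹ z) := by
    rw [Equiv.mul_swap_eq_swap_mul]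
    simp
  have h3 : twistedSum ε (permsOn S) * of ℚ (Perm α) (swap y z) * of ℚ (Perm α) τ *
      twistedSum ε' (labelSubgroup f) = signValue ε' (swap (τ⁻¹ y) (τ⁻¹ z)) • u := by
    rw [mul_assoc (twistedSum ε (permsOn S)), ← map_mul, h2, map_mul, ← mul_assoc, mul_assoc,
      of_mul_twistedSum ε' (swap_mem_labelSubgroup hyz), mul_smul_comm]
  have h4 : signValue ε' (swap (τ⁻¹ y) (τ⁻¹ z)) = signValue ε' (swap y z) := by
    have h5 := congrArg (signValue ε') h2
    rw [signValue_mul, signValue_mul, mul_comm] at h5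
    have h6 : signValue ε' τ ≠ 0 := fun h => by
      have := signValue_mul_self ε' τ
      rw [h] at this
      simp at this
    exact (mul_left_cancel₀ h6 h5).symm
  rw [h1, h4, hε y z hne, ← sub_eq_zero, ← sub_smul] at h3
  refine (smul_eq_zero.1 h3).resolve_left fun h => ?_
  have h5 : signValue ε' (swap y z) = 0 := by linarith
  have := signValue_mul_self ε' (swap y z)
  rw [h5] at this
  simp at this

theorem signValue_sign_swap {x y : α} (h : x ≠ y) : signValue Perm.sign (swap x y) = -1 := by
  rw [signValue, Perm.sign_swap h]
  simp

/-- Either the column of the hook, of length `K.card + 1`, exceeds the number of row labels, or its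
row exceeds the number of column labels; pigeonhole applies in both cases. -/
theorem conjSum_hookSymmetrizer_mul_eq_zero {r c : α → ℕ}
    (hrc : (Finset.univ.image r).card + (Finset.univ.image c).card ≤ Fintype.card α)
    {K : Finset α} {x : α} (hx : x ∉ K) :
    conjSum (hookSymmetrizer Kᶜ K x) *
      (twistedSum 1 (labelSubgroup r) * twistedSum Perm.sign (labelSubgroup c)) = 0 := by
  have hcard := Finset.card_compl_add_card K
  rcases Nat.lt_or_ge (Finset.univ.image r).card (K.card + 1) with h | h
  · rw [conjSum, Finset.sum_mul]
    refine Finset.sum_eq_zero fun τ _ => ?_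
    have h1 := twistedSum_mul_of_mul_twistedSum_eq_zero (ε := Perm.sign) (ε' := 1) (f := r)
      (S := insert x K) (fun y z hyz => by rw [signValue_sign_swap hyz, signValue_trivial])
      (by rwa [Finset.card_insert_of_notMem hx]) τ⁻¹
    rw [hookSymmetrizer, antisymmetrizer]
    calc _ = of ℚ (Perm α) τ * symmetrizer Kᶜ * (twistedSum Perm.sign (permsOn (insert x K)) *
          of ℚ (Perm α) τ⁻¹ * twistedSum 1 (labelSubgroup r)) *
          twistedSum Perm.sign (labelSubgroup c) := by simp only [mul_assoc]
      _ = 0 := by rw [h1, mul_zero, zero_mul]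
  -- Cyclicity and centrality of `conjSum` bring the row symmetrizer of the hook next to the column
  -- antisymmetrizer of the other shape.
  · rw [hookSymmetrizer, conjSum_mul_comm, ← mul_assoc, (conjSum_commute _ _).eq, mul_assoc,
      conjSum, Finset.sum_mul]
    rw [Finset.sum_eq_zero, mul_zero]
    intro τ _
    have h1 := twistedSum_mul_of_mul_twistedSum_eq_zero (ε := 1) (ε' := Perm.sign) (f := c)
      (S := Kᶜ) (fun y z hyz => by rw [signValue_sign_swap hyz, signValue_trivial, neg_neg])
      (by omega) τ⁻¹
    rw [symmetrizer]
    calc _ = of ℚ (Perm α) τ * antisymmetrizer (insert x K) * (twistedSum 1 (permsOn Kᶜ) *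
          of ℚ (Perm α) τ⁻¹ * twistedSum Perm.sign (labelSubgroup c)) := by simp only [mul_assoc]
      _ = 0 := by rw [h1, mul_zero]

theorem exists_finset_hook {k : ℕ} (hk : k < Fintype.card α) :
    ∃ p : Finset α × α, p.1.card = k ∧ p.2 ∉ p.1 := by
  obtain ⟨K, -, hK⟩ := Finset.exists_subset_card_eq (s := (Finset.univ : Finset α))
    (n := k) (by rw [Finset.card_univ]; omega)
  have : K ≠ Finset.univ := by
    rintro rfl
    rw [Finset.card_univ] at hK
    omega
  obtain ⟨x, hx⟩ : ∃ x, x ∉ K := by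
    by_contra! h
    exact this (Finset.eq_univ_iff_forall.2 h)
  exact ⟨(K, x), hK, hx⟩

/-- A central element of the group algebra, a multiple of the sum of the long cycles, annihilates
the Young symmetrizer of every shape with few rows and columns. -/
theorem exists_central_longCycle [Nonempty α] {r c : α → ℕ}
    (hrc : (Finset.univ.image r).card + (Finset.univ.image c).card ≤ Fintype.card α) :
    ∃ z : MonoidAlgebra ℚ (Perm α), (∀ u, Commute z u) ∧
      z * (twistedSum 1 (labelSubgroup r) * twistedSum Perm.sign (labelSubgroup c)) = 0 ∧
      ∀ σ : Perm α, z.coeff σ = (hookPoly σ.partition.parts).eval 1 := by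
  choose! p hp using fun k (hk : k < Fintype.card α) => exists_finset_hook hk
  set h : ℕ → ℚ := fun k => ((p k).1.card.factorial : ℚ) * (((p k).1ᶜ.card - 1).factorial : ℚ) *
    (Fintype.card α : ℚ) with hh
  have hne : ∀ k, h k ≠ 0 := fun k => mul_ne_zero (mul_ne_zero
    (Nat.cast_ne_zero.2 (Nat.factorial_ne_zero _)) (Nat.cast_ne_zero.2 (Nat.factorial_ne_zero _)))
    (Nat.cast_ne_zero.2 Fintype.card_ne_zero)
  -- Dividing by the hook product `h k` normalizes each summand to `(-1)^k` times a hook character,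
  -- so the coefficients add up to the value of `hookPoly` at `1`.
  refine ⟨∑ k ∈ Finset.range (Fintype.card α),
    ((-1) ^ k / h k) • conjSum (hookSymmetrizer (p k).1ᶜ (p k).1 (p k).2), ?_, ?_, ?_⟩
  · exact fun u => Commute.sum_left _ _ _ fun k _ => (conjSum_commute _ _).smul_left _
  · rw [Finset.sum_mul]
    refine Finset.sum_eq_zero fun k hk => ?_
    rw [smul_mul_assoc, conjSum_hookSymmetrizer_mul_eq_zero hrc (hp k (Finset.mem_range.1 hk)).2,
      smul_zero]
  · intro σ
    have hdeg := natDegree_hookPoly_lt (partition_parts_ne_zero σ)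
      (fun m hm => σ.partition.parts_pos hm)
    rw [σ.partition.parts_sum] at hdeg
    rw [Polynomial.eval_eq_sum_range' hdeg, coeff_sum, Finset.sum_apply']
    refine Finset.sum_congr rfl fun k hk => ?_
    have hk' := hp k (Finset.mem_range.1 hk)
    rw [coeff_smul, Finsupp.smul_apply, coeff_conjSum, classAverage_hookSymmetrizer_eq _ _ _ hk'.2,
      smul_eq_mul, ← mul_assoc, div_mul_cancel₀ _ (hne k), hk'.1, ← mul_assoc, ← mul_pow]
    simp

/-- The coefficient of `z` is `d` on long cycles and zero elsewhere, so the vanishing trace of `z`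
is `d` times the number of long cycles times the character value. -/
theorem character_longCycle_eq_zero [Nonempty α] {r c : α → ℕ}
    (hrc : (Finset.univ.image r).card + (Finset.univ.image c).card ≤ Fintype.card α)
    {σ : Perm α} (hσ : σ.partition.parts = {Fintype.card α}) :
    (leftIdealRep (twistedSum 1 (labelSubgroup r) *
      twistedSum Perm.sign (labelSubgroup c))).character σ = 0 := by
  classical
  set V := leftIdealRep (twistedSum 1 (labelSubgroup r) * twistedSum Perm.sign (labelSubgroup c))
  obtain ⟨z, hz, hz0, hcoeff⟩ := exists_central_longCycle hrc
  have h1 := sum_mul_character_leftIdealRep_eq_zero hz hz0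
  have h2 : ∀ τ : Perm α, z.coeff τ * V.character τ =
      if τ.partition = σ.partition then (Fintype.card α : ℚ) * V.character σ else 0 := by
    intro τ
    rw [hcoeff]
    split_ifs with h
    · obtain ⟨π, hπ⟩ := isConj_iff.1 (Perm.partition_eq_of_isConj.2 h.symm)
      rw [h, hσ, ← hπ, Representation.char_conj]
      have := eval_one_hookPoly_cons (Fintype.card α) 0
      simp only [if_true] at this
      rw [← this]
      rfl
    · obtain ⟨m, hm⟩ := Multiset.exists_mem_of_ne_zero (partition_parts_ne_zero τ)
      obtain ⟨t, ht⟩ := Multiset.exists_cons_of_mem hm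
      rw [ht, eval_one_hookPoly_cons, if_neg, zero_mul]
      rintro rfl
      refine h (Nat.Partition.ext ?_)
      have h3 := τ.partition.parts_sum
      rw [ht] at h3
      rw [ht, hσ, ← h3]
      simp
  rw [Finset.sum_congr rfl fun τ _ => h2 τ, ← Finset.sum_filter, Finset.sum_const, smul_eq_zero,
    mul_eq_zero] at h1
  have h3 : (Finset.univ.filter fun τ : Perm α => τ.partition = σ.partition).card ≠ 0 :=
    Finset.card_ne_zero_of_mem (a := σ) (by simp)
  exact (h1.resolve_left h3).resolve_left (Nat.cast_ne_zero.2 Fintype.card_ne_zero)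

end Vanishing

end Hurwitz

end

noncomputable section

namespace Hurwitz

open Equiv MonoidAlgebra

/-! ### Young diagrams of hooks -/

section Diagrams

theorem rowLen_ofRowLens_eq_getD (w : List ℕ) (hw : w.SortedGE) (i : ℕ) :
    (YoungDiagram.ofRowLens w hw).rowLen i = w.getD i 0 := by
  refine eq_of_forall_lt_iff fun j => ?_
  rw [← YoungDiagram.mem_iff_lt_rowLen, YoungDiagram.mem_ofRowLens, List.getD_eq_getElem?_getD]
  by_cases h : i < w.length
  · simp [h]
  · simp [h]

theorem mem_diagram {d : ℕ} (p : d.Partition) (c : ℕ × ℕ) :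
    c ∈ diagram p ↔ c.2 < (p.parts.sort (· ≥ ·)).getD c.1 0 := by
  rw [diagram, ← Prod.mk.eta (p := c), YoungDiagram.mem_iff_lt_rowLen, rowLen_ofRowLens_eq_getD]

/-- The hook partition `(d - k, 1, …, 1)` with `k` parts beyond the first. -/
def hookPartition {d : ℕ} (k : Fin d) : d.Partition where
  parts := (d - k) ::ₘ Multiset.replicate k 1
  parts_pos := by
    intro i hi
    rcases Multiset.mem_cons.1 hi with rfl | hi
    · have := k.2
      omega
    · rw [Multiset.eq_of_mem_replicate hi]
      exact one_pos
  parts_sum := by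
    have := k.2
    simp only [Multiset.sum_cons, Multiset.sum_replicate, smul_eq_mul, mul_one]
    omega

theorem hookPartition_injective {d : ℕ} : Function.Injective (hookPartition (d := d)) := by
  intro k l h
  have h1 := congrArg (fun p : d.Partition => Multiset.card p.parts) h
  simp only [hookPartition, Multiset.card_cons, Multiset.card_replicate] at h1
  exact Fin.ext (by omega)

theorem sort_hookPartition {d : ℕ} (k : Fin d) :
    (hookPartition k).parts.sort (· ≥ ·) = (d - k) :: List.replicate k 1 := by
  have hk := k.2
  rw [hookPartition, Multiset.sort_cons]
  · congr 1
    rw [← Multiset.coe_replicate, Multiset.coe_sort]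
    exact List.mergeSort_eq_self _ (List.pairwise_replicate.2 (Or.inr le_rfl))
  · intro b hb
    rw [Multiset.eq_of_mem_replicate hb]
    omega

theorem rowLen_hookPartition_zero {d : ℕ} (k : Fin d) :
    (diagram (hookPartition k)).rowLen 0 = d - k := by
  rw [diagram, rowLen_ofRowLens_eq_getD, sort_hookPartition]
  rfl

theorem rowLen_hookPartition_succ {d : ℕ} (k : Fin d) (i : ℕ) :
    (diagram (hookPartition k)).rowLen (i + 1) = if i < k then 1 else 0 := by
  rw [diagram, rowLen_ofRowLens_eq_getD, sort_hookPartition, List.getD_cons_succ]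
  split_ifs with h
  · rw [List.getD_replicate _ h]
  · rw [List.getD_eq_default]
    simpa using h

theorem mem_range_hookPartition {d : ℕ} (hd : 0 < d) {p : d.Partition}
    (hp : ((1, 1) : ℕ × ℕ) ∉ diagram p) : p ∈ Set.range (hookPartition (d := d)) := by
  rw [mem_diagram] at hp
  have hsort := Multiset.sort_eq p.parts (· ≥ ·)
  have hsorted := p.parts.pairwise_sort (· ≥ ·)
  generalize p.parts.sort (· ≥ ·) = L at hp hsort hsorted
  cases L with
  | nil =>
    have := p.parts_sum
    rw [← hsort] at this
    simp at this
    omega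
  | cons a L =>
    have hL : ∀ b ∈ L, b = 1 := by
      intro b hb
      have hbp : 0 < b := p.parts_pos (by rw [← hsort]; simp [hb])
      cases L with
      | nil => simp at hb
      | cons e L =>
        simp only [List.getD_cons_succ, List.getD_cons_zero, not_lt] at hp
        rw [List.pairwise_cons, List.pairwise_cons] at hsorted
        rcases List.mem_cons.1 hb with rfl | hb
        · omega
        · have := hsorted.2.1 b hb
          omega
    rw [List.eq_replicate_of_mem hL, ← Multiset.cons_coe, Multiset.coe_replicate] at hsort
    have hsum := p.parts_sum
    rw [← hsort] at hsum
    simp only [Multiset.sum_cons, Multiset.sum_replicate, smul_eq_mul, mul_one] at hsum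
    have ha : 0 < a := p.parts_pos (by rw [← hsort]; simp)
    refine ⟨⟨L.length, by omega⟩, Nat.Partition.ext ?_⟩
    rw [← hsort]
    simp only [hookPartition]
    congr 1
    omega

/-- The first row and column share only the corner, and the cell `(1, 1)` outside both compensates
for it. -/
theorem colLen_add_rowLen_le_card {Y : YoungDiagram} (h : ((1, 1) : ℕ × ℕ) ∈ Y) :
    Y.colLen 0 + Y.rowLen 0 ≤ Y.cells.card := by
  have h00 : ((0, 0) : ℕ × ℕ) ∈ Y := Y.up_left_mem (Nat.zero_le _) (Nat.zero_le _) h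
  have h1 : Y.col 0 ∩ Y.row 0 = {(0, 0)} := by
    ext ⟨i, j⟩
    simp only [Finset.mem_inter, YoungDiagram.mem_col_iff, YoungDiagram.mem_row_iff,
      Finset.mem_singleton, Prod.mk.injEq]
    constructor
    · rintro ⟨⟨-, hj⟩, -, hi⟩
      exact ⟨hi, hj⟩
    · rintro ⟨rfl, rfl⟩
      exact ⟨⟨h00, rfl⟩, h00, rfl⟩
  have h2 := Finset.card_union_add_card_inter (Y.col 0) (Y.row 0)
  have h3 : ((1, 1) : ℕ × ℕ) ∉ Y.col 0 ∪ Y.row 0 := by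
    simp [YoungDiagram.mem_col_iff, YoungDiagram.mem_row_iff]
  have h4 : insert (1, 1) (Y.col 0 ∪ Y.row 0) ⊆ Y.cells := by
    intro c hc
    rw [Finset.mem_insert, Finset.mem_union, YoungDiagram.mem_col_iff,
      YoungDiagram.mem_row_iff] at hc
    rw [YoungDiagram.mem_cells]
    rcases hc with rfl | hc | hc
    · exact h
    · exact hc.1
    · exact hc.1
  have h5 := Finset.card_le_card h4
  rw [Finset.card_insert_of_notMem h3] at h5
  rw [h1, Finset.card_singleton] at h2
  rw [YoungDiagram.colLen_eq_card, YoungDiagram.rowLen_eq_card]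
  omega

end Diagrams

/-! ### Values of the irreducible characters -/

section Characters

theorem youngSymmetrizer_eq (Y : YoungDiagram) :
    youngSymmetrizer Y = twistedSum 1 (labelSubgroup fun c : Y.cells => c.1.1) *
      twistedSum Perm.sign (labelSubgroup fun c : Y.cells => c.1.2) := by
  rw [youngSymmetrizer, rowSymmetrizer, colAntisymmetrizer, twistedSum, twistedSum]
  congr 1
  · refine Finset.sum_congr
      (by ext σ; simp only [Finset.mem_filter, Finset.mem_univ, true_and]; rfl) fun σ _ => ?_
    rw [signValue_trivial, one_smul]
  · exact Finset.sum_congr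
      (by ext σ; simp only [Finset.mem_filter, Finset.mem_univ, true_and]; rfl) fun σ _ => rfl

theorem character_spechtRep {Y : YoungDiagram} {c : MonoidAlgebra ℚ (CellPerm Y)}
    (h : youngSymmetrizer Y = c) (σ : CellPerm Y) :
    (spechtRep Y).character σ = (leftIdealRep c).character σ := by
  subst h
  rfl

theorem chi_indiscrete_eq_zero {d : ℕ} {p : d.Partition} (hp : ((1, 1) : ℕ × ℕ) ∈ diagram p) :
    chi p (Nat.Partition.indiscrete d) = 0 := by
  have hcard := card_cells_diagram p
  have hne : Nonempty (diagram p).cells := ⟨⟨(1, 1), (YoungDiagram.mem_cells _).2 hp⟩⟩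
  have hd : d ≠ 0 := by
    rw [← hcard]
    exact Fintype.card_ne_zero
  rw [chi, character_spechtRep (youngSymmetrizer_eq _)]
  refine character_longCycle_eq_zero ?_ ?_
  · refine le_trans (add_le_add (b := (diagram p).colLen 0) (d := (diagram p).rowLen 0) ?_ ?_)
      ((colLen_add_rowLen_le_card hp).trans (Fintype.card_coe _).ge)
    · refine (Finset.card_le_card (t := Finset.range ((diagram p).colLen 0)) ?_).trans
        (Finset.card_range _).le
      intro i hi
      obtain ⟨⟨⟨i, j⟩, hc⟩, -, rfl⟩ := Finset.mem_image.1 hi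
      rw [Finset.mem_range, ← YoungDiagram.mem_iff_lt_colLen]
      exact YoungDiagram.up_left_mem _ le_rfl (Nat.zero_le j) ((YoungDiagram.mem_cells _).1 hc)
    · refine (Finset.card_le_card (t := Finset.range ((diagram p).rowLen 0)) ?_).trans
        (Finset.card_range _).le
      intro j hj
      obtain ⟨⟨⟨i, j⟩, hc⟩, -, rfl⟩ := Finset.mem_image.1 hj
      rw [Finset.mem_range, ← YoungDiagram.mem_iff_lt_rowLen]
      exact YoungDiagram.up_left_mem _ (Nat.zero_le i) le_rfl ((YoungDiagram.mem_cells _).1 hc)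
  · rw [(exists_perm_parts p (Nat.Partition.indiscrete d)).choose_spec, hcard,
      Nat.Partition.indiscrete_parts hd]

/-- With `K` the cells below the first row, every row but the first and every column but the first
has at most one cell, so the row and column groups are full symmetric groups on `Kᶜ` and `insert x
K`. -/
theorem chi_hookPartition {d : ℕ} (k : Fin d) (q : d.Partition) :
    chi (hookPartition k) q = (-1) ^ (k : ℕ) * (hookPoly q.parts).coeff k := by
  have hk := k.2
  set Y := diagram (hookPartition k) with hY
  have hmem : ∀ i j, ((i, j) : ℕ × ℕ) ∈ Y ↔ j < Y.rowLen i := fun i j =>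
    YoungDiagram.mem_iff_lt_rowLen
  have hrow0 : Y.rowLen 0 = d - k := rowLen_hookPartition_zero k
  have hcol : ∀ {i j}, ((i + 1, j) : ℕ × ℕ) ∈ Y → j = 0 := by
    intro i j h
    rw [hmem, hY, rowLen_hookPartition_succ] at h
    split_ifs at h <;> omega
  have h00 : ((0, 0) : ℕ × ℕ) ∈ Y.cells := by
    rw [YoungDiagram.mem_cells, hmem, hrow0]
    omega
  set x : Y.cells := ⟨(0, 0), h00⟩ with hx
  set K : Finset Y.cells := Finset.univ.filter fun c => c.1.1 ≠ 0 with hK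
  have hxK : x ∉ K := by simp [hK, hx]
  have hKcard : K.card = k := by
    have h1 : Kᶜ.map (Function.Embedding.subtype _) = Y.row 0 := by
      ext c
      simp [hK, YoungDiagram.mem_row_iff, and_comm]
    have h2 : Kᶜ.card = d - k := by
      rw [← Finset.card_map (Function.Embedding.subtype _), h1, ← YoungDiagram.rowLen_eq_card,
        hrow0]
    have h3 := Finset.card_compl_add_card K
    rw [card_cells_diagram] at h3
    omega
  have hrow : (labelSubgroup fun c : Y.cells => c.1.1) = permsOn Kᶜ := by
    ext σ
    constructor
    · rintro h ⟨⟨i, j⟩, hc⟩ ha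
      have h1 := h ⟨(i, j), hc⟩
      have h2 : i ≠ 0 := by simpa [hK] using ha
      obtain ⟨i, rfl⟩ := Nat.exists_eq_succ_of_ne_zero h2
      have hj := hcol ((YoungDiagram.mem_cells _).1 hc)
      generalize σ ⟨(i + 1, j), hc⟩ = b at h1 ⊢
      obtain ⟨⟨i', j'⟩, hc'⟩ := b
      simp only at h1
      subst h1
      have hj' := hcol ((YoungDiagram.mem_cells _).1 hc')
      subst hj hj'
      rfl
    · intro h a
      by_cases ha : a ∈ Kᶜ
      · have h1 := (apply_mem_iff_of_mem_permsOn h a).2 ha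
        simp only [hK, Finset.mem_compl, Finset.mem_filter, Finset.mem_univ, true_and,
          not_not] at ha h1
        change (σ a).1.1 = a.1.1
        rw [ha, h1]
      · rw [h a ha]
  have hcolS : (labelSubgroup fun c : Y.cells => c.1.2) = permsOn (insert x K) := by
    have hmemS : ∀ c : Y.cells, c ∈ insert x K ↔ c.1.2 = 0 := by
      rintro ⟨⟨i, j⟩, hc⟩
      rw [Finset.mem_insert, hK, Finset.mem_filter, hx]
      simp only [Subtype.mk.injEq, Prod.mk.injEq, Finset.mem_univ, true_and]
      constructor
      · rintro (h | h)
        · exact h.2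
        · obtain ⟨i, rfl⟩ := Nat.exists_eq_succ_of_ne_zero h
          exact hcol ((YoungDiagram.mem_cells _).1 hc)
      · intro h
        by_cases hi : i = 0
        · exact Or.inl ⟨hi, h⟩
        · exact Or.inr hi
    have hrowz : ∀ c : Y.cells, c.1.2 ≠ 0 → c.1.1 = 0 := by
      rintro ⟨⟨i, j⟩, hc⟩ h
      by_contra hi
      obtain ⟨i, rfl⟩ := Nat.exists_eq_succ_of_ne_zero hi
      exact h (hcol ((YoungDiagram.mem_cells _).1 hc))
    ext σ
    constructor
    · intro h a ha
      rw [hmemS] at ha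
      have h1 : (σ a).1.2 = a.1.2 := h a
      refine Subtype.ext (Prod.ext ?_ h1)
      rw [hrowz a ha, hrowz (σ a) (by rwa [h1])]
    · intro h a
      by_cases ha : a ∈ insert x K
      · have h1 := (apply_mem_iff_of_mem_permsOn h a).2 ha
        rw [hmemS] at ha h1
        change (σ a).1.2 = a.1.2
        rw [ha, h1]
      · rw [h a ha]
  have hsym : youngSymmetrizer Y = hookSymmetrizer Kᶜ K x := by
    rw [youngSymmetrizer_eq, hrow, hcolS, hookSymmetrizer, symmetrizer, antisymmetrizer]
  rw [chi, character_spechtRep hsym, character_hookSymmetrizer _ _ _ hxK,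
    (exists_perm_parts (hookPartition k) q).choose_spec, hKcard]

/-- The rows of length one telescope, and the first row cancels the remaining `(-1/2)^e`. -/
theorem shiftedPowerSum_hookPartition {d : ℕ} (k : Fin d) (e : ℕ) :
    shiftedPowerSum e (hookPartition k) =
      ((d : ℚ) - k - 1 / 2) ^ e - (-((k : ℕ) + 1 / 2 : ℚ)) ^ e := by
  have hk := k.2
  rw [shiftedPowerSum, finsum_eq_sum_of_support_subset (s := Finset.range (k + 1))]
  · rw [Finset.sum_range_succ', rowLen_hookPartition_zero]
    have h1 : ∀ m ≤ (k : ℕ), ∑ i ∈ Finset.range m,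
        ((((diagram (hookPartition k)).rowLen (i + 1) : ℚ) - (((i + 1 : ℕ) : ℚ) + 1) + 1 / 2) ^ e
          - (-(((i + 1 : ℕ) : ℚ) + 1) + 1 / 2) ^ e) = (-1 / 2) ^ e - (-((m : ℚ) + 1 / 2)) ^ e := by
      intro m
      induction m with
      | zero => intro _; norm_num
      | succ m ih =>
        intro hm
        rw [Finset.sum_range_succ, ih (by omega), rowLen_hookPartition_succ, if_pos (by omega)]
        push_cast
        ring
    rw [h1 k le_rfl, Nat.cast_sub hk.le]
    push_cast
    ring
  · intro i hi
    rw [Finset.coe_range, Set.mem_Iio]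
    by_contra h
    obtain ⟨i, rfl⟩ : ∃ j, i = j + 1 := ⟨i - 1, by omega⟩
    refine hi ?_
    beta_reduce
    rw [rowLen_hookPartition_succ, if_neg (by omega)]
    simp

theorem doubleHurwitz_eq_sum {d : ℕ} (hd : 0 < d) (g s : ℕ) (β : d.Partition)
    (hs : 2 * s + 2 = 2 * g + Multiset.card (Nat.Partition.indiscrete d).parts
      + Multiset.card β.parts) :
    doubleHurwitz g 2 s (Nat.Partition.indiscrete d) β hs
      = 1 / ((d : ℚ) * (β.parts.prod : ℚ)) * ∑ k ∈ Finset.range d, (hookPoly β.parts).coeff k *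
        ((d : ℚ) / 2 * (((k : ℚ) + 1 / 2 - d / 2) ^ 2 + (d : ℚ) ^ 2 / 12)) ^ s := by
  rw [doubleHurwitz, Nat.Partition.indiscrete_parts hd.ne', Multiset.prod_singleton]
  congr 1
  rw [Finset.sum_range]
  symm
  refine Fintype.sum_of_injective hookPartition hookPartition_injective _ _ ?_ ?_
  · intro p hp
    rw [chi_indiscrete_eq_zero (by_contra fun h => hp (mem_range_hookPartition hd h)), zero_mul,
      zero_mul]
  · intro k
    rw [chi_hookPartition, chi_hookPartition, Nat.Partition.indiscrete_parts hd.ne',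
      coeff_hookPoly_singleton k.2, shiftedPowerSum_hookPartition]
    have h1 : ((-1 : ℚ) ^ (k : ℕ)) * (-1) ^ (k : ℕ) = 1 := by
      rw [← mul_pow]
      norm_num
    -- With `u = k + 1/2 - d/2` the numerator is `(d/2 - u)³ + (d/2 + u)³`, so the odd powers of `u`
    -- drop out.
    have h2 : (((d : ℚ) - k - 1 / 2) ^ (2 + 1) - (-((k : ℕ) + 1 / 2 : ℚ)) ^ (2 + 1)) /
        ((2 + 1).factorial : ℚ)
        = (d : ℚ) / 2 * (((k : ℚ) + 1 / 2 - d / 2) ^ 2 + (d : ℚ) ^ 2 / 12) := by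
      norm_num [Nat.factorial]
      ring
    rw [h2]
    linear_combination (-(hookPoly β.parts).coeff k *
        ((d : ℚ) / 2 * (((k : ℚ) + 1 / 2 - d / 2) ^ 2 + (d : ℚ) ^ 2 / 12)) ^ s) * h1

end Characters

end Hurwitz

end

noncomputable section

namespace Hurwitz

/-! ### The power series `sinh (t / 2) / (t / 2)` -/

section SinhSeries

open PowerSeries

/-- The power series `exp (a t)`. -/
def expSeries (a : ℚ) : ℚ⟦X⟧ := rescale a (exp ℚ)

theorem coeff_expSeries (a : ℚ) (m : ℕ) : coeff m (expSeries a) = a ^ m / (m.factorial : ℚ) := by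
  rw [expSeries, coeff_rescale, coeff_exp]
  simp [div_eq_mul_inv]

theorem expSeries_add (a b : ℚ) : expSeries (a + b) = expSeries a * expSeries b :=
  (exp_mul_exp_eq_exp_add a b).symm

theorem expSeries_zero : expSeries 0 = 1 := by
  ext m
  rw [coeff_expSeries, coeff_one]
  rcases Nat.eq_zero_or_pos m with rfl | hm
  · simp
  · simp [hm.ne']

theorem expSeries_natCast (k : ℕ) : expSeries k = expSeries 1 ^ k := by
  induction k with
  | zero => simp [expSeries_zero]
  | succ k ih => rw [Nat.cast_succ, expSeries_add, ih, pow_succ]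

theorem expSeries_sum {ι : Type*} (s : Finset ι) (f : ι → ℚ) :
    expSeries (∑ i ∈ s, f i) = ∏ i ∈ s, expSeries (f i) := by
  classical
  induction s using Finset.induction_on with
  | empty => simp [expSeries_zero]
  | insert a s ha ih => rw [Finset.sum_insert ha, Finset.prod_insert ha, expSeries_add, ih]

/-- The power series `sinh (t / 2) / (t / 2)`. -/
def sinhSeries : ℚ⟦X⟧ := mk fun i => coeff (i + 1) (expSeries (1 / 2) - expSeries (-(1 / 2)))

theorem coeff_sinhSeries (i : ℕ) :
    coeff i sinhSeries = ((1 / 2) ^ (i + 1) - (-(1 / 2)) ^ (i + 1)) / ((i + 1).factorial : ℚ) := by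
  rw [sinhSeries, coeff_mk, map_sub, coeff_expSeries, coeff_expSeries, sub_div]

theorem coeff_sinhSeries_nonneg (i : ℕ) : 0 ≤ coeff i sinhSeries := by
  rw [coeff_sinhSeries]
  refine div_nonneg ?_ (Nat.cast_nonneg _)
  rcases Nat.even_or_odd (i + 1) with h | h
  · rw [h.neg_pow, sub_self]
  · rw [h.neg_pow, sub_neg_eq_add]
    positivity

theorem constantCoeff_sinhSeries : constantCoeff sinhSeries = 1 := by
  rw [← coeff_zero_eq_constantCoeff_apply, coeff_sinhSeries]
  norm_num

theorem X_mul_sinhSeries : X * sinhSeries = expSeries (1 / 2) - expSeries (-(1 / 2)) := by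
  ext m
  cases m with
  | zero =>
    rw [coeff_zero_X_mul, map_sub, coeff_expSeries, coeff_expSeries]
    simp
  | succ m => rw [coeff_succ_X_mul, sinhSeries, coeff_mk]

theorem X_mul_rescale_sinhSeries (b : ℚ) :
    C b * X * rescale b sinhSeries = expSeries (b / 2) - expSeries (-(b / 2)) := by
  have h := congrArg (rescale b) X_mul_sinhSeries
  rw [map_mul, rescale_X, map_sub, expSeries, expSeries, rescale_rescale, rescale_rescale] at h
  rw [h, expSeries, expSeries]
  congr 3 <;> ring

/-- With `y = e^{t/2}` this is `1/(y - y⁻¹) = 1/(y - 1) - 1/(y² - 1)` multiplied by `t`. -/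
theorem sinhSeries_inv_eq : sinhSeries⁻¹
    = C 2 * rescale (1 / 2) (bernoulliPowerSeries ℚ) - bernoulliPowerSeries ℚ := by
  have hc : constantCoeff sinhSeries ≠ 0 := by
    rw [constantCoeff_sinhSeries]
    exact one_ne_zero
  symm
  rw [PowerSeries.eq_inv_iff_mul_eq_one hc]
  refine mul_left_cancel₀ X_ne_zero ?_
  have h1 : bernoulliPowerSeries ℚ * (expSeries 1 - 1) = X := by
    rw [← bernoulliPowerSeries_mul_exp_sub_one ℚ, expSeries, rescale_one]
    rfl
  have h2 := congrArg (rescale (1 / 2 : ℚ)) h1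
  rw [map_mul, map_sub, map_one, rescale_X, expSeries, rescale_rescale, one_mul, ← expSeries] at h2
  have h3 : expSeries 1 = expSeries (1 / 2) * expSeries (1 / 2) := by
    rw [← expSeries_add]
    norm_num
  have h4 : expSeries (1 / 2) * expSeries (-(1 / 2)) = 1 := by
    rw [← expSeries_add, add_neg_cancel, expSeries_zero]
  have h5 : (C 2 : ℚ⟦X⟧) * C (1 / 2) = 1 := by
    rw [← map_mul]
    norm_num
  rw [h3] at h1
  calc X * ((C 2 * rescale (1 / 2) (bernoulliPowerSeries ℚ) - bernoulliPowerSeries ℚ) * sinhSeries)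
      = (C 2 * rescale (1 / 2) (bernoulliPowerSeries ℚ) - bernoulliPowerSeries ℚ) *
          (expSeries (1 / 2) - expSeries (-(1 / 2))) := by rw [← X_mul_sinhSeries]; ring
    _ = X * 1 := by
      linear_combination (C 2 * (1 + expSeries (-(1 / 2)))) * h2
        - (expSeries (-(1 / 2))) * h1
        + X * (1 + expSeries (-(1 / 2))) * h5
        + (bernoulliPowerSeries ℚ * expSeries (1 / 2)
          - C 2 * rescale (1 / 2) (bernoulliPowerSeries ℚ)) * h4

/-- Euler's formula makes `ζ(2g)` a multiple of the Bernoulli number, and zeta has no zero with real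
part at least one. -/
theorem bernoulli_two_mul_ne_zero (g : ℕ) : bernoulli (2 * g) ≠ 0 := by
  rcases eq_or_ne g 0 with rfl | hg
  · simp
  intro h
  have h1 := riemannZeta_two_mul_nat hg
  rw [h] at h1
  have h2 : riemannZeta (2 * g) ≠ 0 := by
    refine riemannZeta_ne_zero_of_one_le_re ?_
    have : (1 : ℝ) ≤ g := by exact_mod_cast Nat.one_le_iff_ne_zero.2 hg
    simp
    linarith
  refine h2 ?_
  rw [h1]
  simp

theorem coeff_sinhSeries_inv_ne_zero (g : ℕ) : coeff (2 * g) sinhSeries⁻¹ ≠ 0 := by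
  rw [sinhSeries_inv_eq, map_sub, coeff_C_mul, coeff_rescale, bernoulliPowerSeries, coeff_mk,
    ← mul_assoc, ← sub_one_mul]
  refine mul_ne_zero ?_ ?_
  · rcases Nat.eq_zero_or_pos g with rfl | hg
    · norm_num
    · have h1 : (1 / 2 : ℚ) ^ (2 * g) ≤ (1 / 2) ^ 2 :=
        pow_le_pow_of_le_one (by norm_num) (by norm_num) (by omega)
      intro h
      norm_num at h1 h
      linarith
  · simpa using ⟨bernoulli_two_mul_ne_zero g, Nat.factorial_ne_zero _⟩

/-- Moments of the hook coefficients. -/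
theorem sum_coeff_hookPoly_mul_pow {n d : ℕ} (hn : Odd n) (b : Fin n → ℕ) (hb : ∀ i, 0 < b i)
    (hd : ∑ i, b i = d) (m : ℕ) :
    ∑ k ∈ Finset.range d, (hookPoly (Finset.univ.val.map b)).coeff k *
        ((k : ℚ) + 1 / 2 - d / 2) ^ m
      = (m.factorial : ℚ) * (∏ i, (b i : ℚ)) *
        coeff m (X ^ (n - 1) * ((∏ i, rescale (b i : ℚ) sinhSeries) * sinhSeries⁻¹)) := by
  set R := hookPoly (Finset.univ.val.map b) with hR
  have hs : (Finset.univ.val.map b : Multiset ℕ) ≠ 0 := by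
    rw [← Multiset.card_pos]
    simpa using hn.pos
  have hsum : (Finset.univ.val.map b).sum = d := hd
  have hdeg : R.natDegree < d := by
    rw [← hsum]
    refine natDegree_hookPoly_lt hs fun k hk => ?_
    obtain ⟨i, -, rfl⟩ := Multiset.mem_map.1 hk
    exact hb i
  -- The exponential generating function of the centred moments.
  set M : ℚ⟦X⟧ := ∑ k ∈ Finset.range d, C (R.coeff k) * expSeries ((k : ℚ) + 1 / 2 - d / 2) with hM
  have h1 := congrArg (Polynomial.aeval (expSeries 1)) (one_sub_X_mul_hookPoly hs)
  rw [Multiset.map_map] at h1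
  change Polynomial.aeval (expSeries 1) ((1 - Polynomial.X) * R)
    = Polynomial.aeval (expSeries 1) (∏ i, (1 - Polynomial.X ^ b i)) at h1
  rw [map_mul, map_sub, map_one, Polynomial.aeval_X, map_prod,
    Polynomial.aeval_eq_sum_range' hdeg] at h1
  have h2 : M = (∑ k ∈ Finset.range d, R.coeff k • expSeries 1 ^ k) *
      expSeries (1 / 2 - d / 2) := by
    rw [hM, Finset.sum_mul]
    refine Finset.sum_congr rfl fun k _ => ?_
    rw [add_sub_assoc, expSeries_add, expSeries_natCast, smul_eq_C_mul, mul_assoc]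
  -- The substitution `X = e^t` in `(1 - X) R = ∏ (1 - X^{b i})`; since `d = ∑ b i`, the centring
  -- factor `e^{-dt/2}` is shared out among the factors and turns each into a hyperbolic sine.
  have h3 : X * sinhSeries * M = ∏ i, (C (b i : ℚ) * X * rescale (b i : ℚ) sinhSeries) := by
    have h4 : expSeries (1 / 2) - expSeries (-(1 / 2))
        = (-1) * ((1 - expSeries 1) * expSeries (-(1 / 2))) := by
      have h5 : expSeries (1 / 2) = expSeries 1 * expSeries (-(1 / 2)) := by
        rw [← expSeries_add]
        norm_num
      rw [h5]
      ring
    have h6 : expSeries (-(1 / 2)) * expSeries (1 / 2 - d / 2)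
        = ∏ i, expSeries (-((b i : ℚ) / 2)) := by
      rw [← expSeries_add, ← expSeries_sum, Finset.sum_neg_distrib, ← Finset.sum_div, ← hd]
      push_cast
      congr 1
      ring
    -- Oddness of `n` balances the sign of the single denominator against those of the `n`
    -- numerators.
    have h7 : (-1 : ℚ⟦X⟧) = ∏ _i : Fin n, (-1) := by
      rw [Finset.prod_const, Finset.card_univ, Fintype.card_fin, hn.neg_one_pow]
    calc X * sinhSeries * M
        = (-1) * (((1 - expSeries 1) * ∑ k ∈ Finset.range d, R.coeff k • expSeries 1 ^ k) *
            (expSeries (-(1 / 2)) * expSeries (1 / 2 - d / 2))) := by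
          rw [X_mul_sinhSeries, h4, h2]
          ring
      _ = ∏ i, (-1) * ((1 - expSeries 1 ^ b i) * expSeries (-((b i : ℚ) / 2))) := by
          rw [h1, h6, ← Finset.prod_mul_distrib, Finset.prod_mul_distrib (f := fun _ => (-1 : ℚ⟦X⟧)),
            ← h7]
          congr 1
          refine Finset.prod_congr rfl fun i _ => ?_
          simp
      _ = _ := by
          refine Finset.prod_congr rfl fun i _ => ?_
          rw [X_mul_rescale_sinhSeries, ← expSeries_natCast]
          have h8 : expSeries ((b i : ℚ) / 2) = expSeries (b i) * expSeries (-((b i : ℚ) / 2)) := by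
            rw [← expSeries_add]
            congr 1
            ring
          rw [h8]
          ring
  have h9 : M = C (∏ i, (b i : ℚ)) *
      (X ^ (n - 1) * ((∏ i, rescale (b i : ℚ) sinhSeries) * sinhSeries⁻¹)) := by
    have hc : constantCoeff sinhSeries ≠ 0 := by
      rw [constantCoeff_sinhSeries]
      exact one_ne_zero
    have hinv := PowerSeries.mul_inv_cancel sinhSeries hc
    have hX : (X : ℚ⟦X⟧) ^ n = X * X ^ (n - 1) := by
      rw [← pow_succ', Nat.sub_add_cancel hn.pos]
    rw [Finset.prod_mul_distrib, Finset.prod_mul_distrib, Finset.prod_const, Finset.card_univ,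
      Fintype.card_fin, ← map_prod, hX] at h3
    refine mul_left_cancel₀ X_ne_zero ?_
    linear_combination sinhSeries⁻¹ * h3 - X * M * hinv
  have h10 := congrArg (coeff m) h9
  rw [coeff_C_mul, hM, map_sum] at h10
  rw [mul_assoc, ← h10, Finset.mul_sum]
  refine Finset.sum_congr rfl fun k _ => ?_
  have hm : (m.factorial : ℚ) ≠ 0 := Nat.cast_ne_zero.2 (Nat.factorial_ne_zero m)
  rw [coeff_C_mul, coeff_expSeries]
  field_simp

end SinhSeries

end Hurwitz

end

noncomputable section

namespace Hurwitz

/-! ### The polynomial -/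

section Polynomiality

open MvPolynomial

variable {n : ℕ}

/-- The coefficients of the product of the series `sinh (x t / 2) / (x t / 2)` over the variables
`x`, as polynomials in the variables. -/
def sinhProdCoeff (n i : ℕ) : MvPolynomial (Fin n) ℚ :=
  PowerSeries.coeff i (∏ j : Fin n,
    PowerSeries.rescale (X j : MvPolynomial (Fin n) ℚ) (PowerSeries.map C sinhSeries))

theorem isHomogeneous_sinhProdCoeff (n i : ℕ) : (sinhProdCoeff n i).IsHomogeneous i := by
  rw [sinhProdCoeff]
  generalize (Finset.univ : Finset (Fin n)) = s
  classical
  induction s using Finset.induction_on generalizing i with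
  | empty =>
    rw [Finset.prod_empty, PowerSeries.coeff_one]
    split_ifs with h
    · rw [h]
      exact isHomogeneous_one _ _
    · exact isHomogeneous_zero _ _ _
  | insert a s ha ih =>
    rw [Finset.prod_insert ha, PowerSeries.coeff_mul]
    refine IsHomogeneous.sum _ _ _ fun p hp => ?_
    rw [← Finset.HasAntidiagonal.mem_antidiagonal.1 hp]
    refine IsHomogeneous.mul ?_ (ih p.2)
    rw [PowerSeries.coeff_rescale, PowerSeries.coeff_map]
    simpa using (isHomogeneous_X_pow (R := ℚ) a p.1).mul (isHomogeneous_C (Fin n)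
      (PowerSeries.coeff p.1 sinhSeries))

theorem eval_sinhProdCoeff (b : Fin n → ℚ) (i : ℕ) :
    eval b (sinhProdCoeff n i)
      = PowerSeries.coeff i (∏ j, PowerSeries.rescale (b j) sinhSeries) := by
  rw [sinhProdCoeff, ← PowerSeries.coeff_map, map_prod]
  congr 1
  refine Finset.prod_congr rfl fun j _ => ?_
  ext m
  rw [PowerSeries.coeff_map, PowerSeries.coeff_rescale, PowerSeries.coeff_map,
    PowerSeries.coeff_rescale]
  simp

theorem eval_one_sinhProdCoeff_nonneg (n i : ℕ) :
    0 ≤ eval (fun _ => (1 : ℚ)) (sinhProdCoeff n i) := by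
  rw [eval_sinhProdCoeff]
  generalize (Finset.univ : Finset (Fin n)) = s
  classical
  induction s using Finset.induction_on generalizing i with
  | empty =>
    rw [Finset.prod_empty, PowerSeries.coeff_one]
    split_ifs <;> norm_num
  | insert a s ha ih =>
    rw [Finset.prod_insert ha, PowerSeries.coeff_mul]
    refine Finset.sum_nonneg fun p _ => mul_nonneg ?_ (ih p.2)
    rw [PowerSeries.coeff_rescale, one_pow, one_mul]
    exact coeff_sinhSeries_nonneg p.1

theorem eval_sinhProdCoeff_zero (b : Fin n → ℚ) : eval b (sinhProdCoeff n 0) = 1 := by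
  rw [eval_sinhProdCoeff, PowerSeries.coeff_zero_eq_constantCoeff_apply, map_prod]
  refine Finset.prod_eq_one fun j _ => ?_
  rw [← PowerSeries.coeff_zero_eq_constantCoeff_apply, PowerSeries.coeff_rescale, pow_zero, one_mul,
    PowerSeries.coeff_zero_eq_constantCoeff_apply, constantCoeff_sinhSeries]

/-- The combinatorial weight of the moment of order `2 (h + j)`. -/
def momentWeight (g h j : ℕ) : ℚ :=
  ((g + h).choose (h + j) : ℚ) * ((2 * (h + j)).factorial : ℚ) / 12 ^ (g - j)

theorem momentWeight_pos {g h j : ℕ} (hj : j ≤ g) : 0 < momentWeight g h j := by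
  have h1 : 0 < (g + h).choose (h + j) := Nat.choose_pos (by omega)
  have h2 := Nat.factorial_pos (2 * (h + j))
  rw [momentWeight]
  positivity

/-- The monomials in the sum of the variables and the coefficients of the sinh product from which
the one-part double Hurwitz polynomial is assembled. -/
def hurwitzTerm (g h j : ℕ) (p : ℕ × ℕ) : MvPolynomial (Fin (2 * h + 1)) ℚ :=
  C (1 / 2 ^ (g + h) * (momentWeight g h j * PowerSeries.coeff p.2 sinhSeries⁻¹)) *
    ((∑ i, X i) ^ (g + h - 1 + 2 * (g - j)) * sinhProdCoeff (2 * h + 1) p.1)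

/-- The one-part double Hurwitz polynomial with completed 3-cycles in `2 h + 1` variables. -/
def hurwitzPoly (g h : ℕ) : MvPolynomial (Fin (2 * h + 1)) ℚ :=
  ∑ j ∈ Finset.range (g + 1), ∑ p ∈ Finset.HasAntidiagonal.antidiagonal (2 * j),
    hurwitzTerm g h j p

theorem isHomogeneous_hurwitzTerm (g h j : ℕ) (p : ℕ × ℕ) :
    (hurwitzTerm g h j p).IsHomogeneous (g + h - 1 + 2 * (g - j) + p.1) := by
  rw [hurwitzTerm]
  have h1 : (∑ i, X i : MvPolynomial (Fin (2 * h + 1)) ℚ).IsHomogeneous 1 :=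
    IsHomogeneous.sum _ _ _ fun i _ => isHomogeneous_X ℚ i
  have h2 := (h1.pow (g + h - 1 + 2 * (g - j))).mul (isHomogeneous_sinhProdCoeff (2 * h + 1) p.1)
  rw [one_mul] at h2
  simpa using (isHomogeneous_C (Fin (2 * h + 1)) (1 / 2 ^ (g + h) *
    (momentWeight g h j * PowerSeries.coeff p.2 sinhSeries⁻¹))).mul h2

theorem homogeneousComponent_hurwitzPoly (g h N : ℕ) :
    homogeneousComponent N (hurwitzPoly g h) =
      ∑ j ∈ Finset.range (g + 1), ∑ p ∈ Finset.HasAntidiagonal.antidiagonal (2 * j),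
        if N = g + h - 1 + 2 * (g - j) + p.1 then hurwitzTerm g h j p else 0 := by
  rw [hurwitzPoly, map_sum]
  refine Finset.sum_congr rfl fun j _ => ?_
  rw [map_sum]
  refine Finset.sum_congr rfl fun p _ => ?_
  rw [homogeneousComponent_of_mem ((mem_homogeneousSubmodule _ _).2
    (isHomogeneous_hurwitzTerm g h j p))]

theorem eval_hurwitzTerm (g h j : ℕ) (p : ℕ × ℕ) (b : Fin (2 * h + 1) → ℚ) :
    eval b (hurwitzTerm g h j p) =
      1 / 2 ^ (g + h) * (momentWeight g h j * PowerSeries.coeff p.2 sinhSeries⁻¹) *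
        ((∑ i, b i) ^ (g + h - 1 + 2 * (g - j)) * eval b (sinhProdCoeff (2 * h + 1) p.1)) := by
  simp [hurwitzTerm]

/-- Only `j = g` with all of `t^{2g}` taken from `1/S` reaches this degree; that term is a nonzero
constant times a power of the sum of the variables. -/
theorem isLeast_homogeneousDegrees_hurwitzPoly (g h : ℕ) :
    IsLeast (homogeneousDegrees (hurwitzPoly g h)) (g + h - 1) := by
  constructor
  · change homogeneousComponent _ _ ≠ 0
    rw [homogeneousComponent_hurwitzPoly, Finset.sum_eq_single_of_mem g (by simp),
      Finset.sum_eq_single_of_mem (0, 2 * g) (by simp)]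
    · rw [if_pos (by simp)]
      intro h0
      have h1 := congrArg (eval fun _ => (1 : ℚ)) h0
      rw [eval_hurwitzTerm, eval_sinhProdCoeff_zero, map_zero] at h1
      refine absurd h1 (mul_ne_zero (mul_ne_zero (by positivity) (mul_ne_zero
        (momentWeight_pos le_rfl).ne' (coeff_sinhSeries_inv_ne_zero g))) ?_)
      rw [mul_one]
      refine pow_ne_zero _ ?_
      simp
      positivity
    · rintro ⟨i, l⟩ hp hne
      rw [if_neg]
      rintro h0
      have := Finset.HasAntidiagonal.mem_antidiagonal.1 hp
      simp only [ne_eq, Prod.mk.injEq] at hne this h0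
      omega
    · intro j hj hne
      refine Finset.sum_eq_zero fun p _ => if_neg ?_
      have := Finset.mem_range.1 hj
      omega
  · intro N hN
    by_contra h0
    refine hN ?_
    rw [homogeneousComponent_hurwitzPoly]
    exact Finset.sum_eq_zero fun j _ => Finset.sum_eq_zero fun p _ => if_neg (by omega)

/-- Each `j` contributes through the pair `(2j, 0)`, where `1/S` has constant term `1`. At the
all-ones point every contribution is nonnegative and that of `j = 0` is positive. -/
theorem isGreatest_homogeneousDegrees_hurwitzPoly (g h : ℕ) :
    IsGreatest (homogeneousDegrees (hurwitzPoly g h)) (g + h - 1 + 2 * g) := by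
  constructor
  · change homogeneousComponent _ _ ≠ 0
    intro h0
    have h1 := congrArg (eval fun _ => (1 : ℚ)) h0
    rw [map_zero, homogeneousComponent_hurwitzPoly, map_sum] at h1
    refine absurd h1 (ne_of_gt ?_)
    have hterm : ∀ j ∈ Finset.range (g + 1), eval (fun _ => (1 : ℚ))
        (∑ p ∈ Finset.HasAntidiagonal.antidiagonal (2 * j),
          if g + h - 1 + 2 * g = g + h - 1 + 2 * (g - j) + p.1 then hurwitzTerm g h j p else 0)
        = 1 / 2 ^ (g + h) * momentWeight g h j * ((2 * h + 1 : ℕ) : ℚ) ^ (g + h - 1 + 2 * (g - j)) *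
          eval (fun _ => (1 : ℚ)) (sinhProdCoeff (2 * h + 1) (2 * j)) := by
      intro j hj
      have hj' := Finset.mem_range.1 hj
      rw [Finset.sum_eq_single_of_mem (2 * j, 0) (by simp)]
      · rw [if_pos (by simp only; omega), eval_hurwitzTerm,
          PowerSeries.coeff_zero_eq_constantCoeff_apply, PowerSeries.constantCoeff_inv,
          constantCoeff_sinhSeries]
        simp
        ring
      · rintro ⟨i, l⟩ hp hne
        rw [if_neg]
        rintro h0
        have := Finset.HasAntidiagonal.mem_antidiagonal.1 hp
        simp only [ne_eq, Prod.mk.injEq] at hne this h0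
        omega
    rw [Finset.sum_congr rfl hterm]
    have hpos : ∀ j ∈ Finset.range (g + 1), 0 < 1 / 2 ^ (g + h) * momentWeight g h j *
        ((2 * h + 1 : ℕ) : ℚ) ^ (g + h - 1 + 2 * (g - j)) := by
      intro j hj
      have h2 := momentWeight_pos (g := g) (h := h) (Nat.lt_succ_iff.1 (Finset.mem_range.1 hj))
      positivity
    refine Finset.sum_pos' (fun j hj => mul_nonneg (hpos j hj).le
      (eval_one_sinhProdCoeff_nonneg _ _)) ⟨0, by simp, ?_⟩
    refine mul_pos (hpos 0 (by simp)) ?_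
    rw [mul_zero, eval_sinhProdCoeff_zero]
    exact one_pos
  · intro N hN
    by_contra h0
    refine hN ?_
    rw [homogeneousComponent_hurwitzPoly]
    refine Finset.sum_eq_zero fun j hj => Finset.sum_eq_zero fun p hp => if_neg ?_
    have h1 := Finset.HasAntidiagonal.mem_antidiagonal.1 hp
    have h2 := Finset.mem_range.1 hj
    omega

theorem eval_hurwitzPoly (g h : ℕ) (b : Fin (2 * h + 1) → ℚ) :
    eval b (hurwitzPoly g h) = 1 / 2 ^ (g + h) * ∑ j ∈ Finset.range (g + 1), momentWeight g h j *
      (∑ i, b i) ^ (g + h - 1 + 2 * (g - j)) *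
        PowerSeries.coeff (2 * j)
          ((∏ i, PowerSeries.rescale (b i) sinhSeries) * sinhSeries⁻¹) := by
  rw [hurwitzPoly, map_sum, Finset.mul_sum]
  refine Finset.sum_congr rfl fun j _ => ?_
  rw [map_sum, PowerSeries.coeff_mul, Finset.mul_sum, Finset.mul_sum]
  refine Finset.sum_congr rfl fun p _ => ?_
  rw [eval_hurwitzTerm, eval_sinhProdCoeff]
  ring

theorem doubleHurwitz_eq_eval {d : ℕ} (g h : ℕ) (hgh : g + h ≠ 0) (β : d.Partition)
    (b : Fin (2 * h + 1) → ℕ) (hβ : β.parts = Multiset.map b Finset.univ.val)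
    (hs : 2 * (g + h) + 2 = 2 * g + Multiset.card (Nat.Partition.indiscrete d).parts
      + Multiset.card β.parts) :
    doubleHurwitz g 2 (g + h) (Nat.Partition.indiscrete d) β hs
      = eval (fun i => (b i : ℚ)) (hurwitzPoly g h) := by
  have hb : ∀ i, 0 < b i := fun i => β.parts_pos (by
    rw [hβ]
    exact Multiset.mem_map_of_mem b (Finset.mem_univ_val i))
  have hsum : ∑ i, b i = d := by
    rw [← β.parts_sum, hβ]
    rfl
  have hd : 0 < d := by
    rw [← hsum]
    exact Finset.sum_pos (fun i _ => hb i) ⟨0, Finset.mem_univ _⟩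
  have hsumQ : ∑ i, (b i : ℚ) = d := by
    rw [← hsum]
    push_cast
    rfl
  have hprod : ((Multiset.map b Finset.univ.val).prod : ℚ) = ∏ i, (b i : ℚ) := by
    rw [← Nat.cast_prod]
    rfl
  have hprod0 : (∏ i, (b i : ℚ)) ≠ 0 :=
    Finset.prod_ne_zero_iff.2 fun i _ => Nat.cast_ne_zero.2 (hb i).ne'
  have hd0 : (d : ℚ) ≠ 0 := Nat.cast_ne_zero.2 hd.ne'
  rw [doubleHurwitz_eq_sum hd, eval_hurwitzPoly, hβ, hprod, hsumQ]
  set T := (∏ i, PowerSeries.rescale (b i : ℚ) sinhSeries) * sinhSeries⁻¹ with hT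
  -- Binomial expansion of the power, with the sums exchanged to expose the even moments.
  have h1 : ∑ k ∈ Finset.range d, (hookPoly (Multiset.map b Finset.univ.val)).coeff k *
      ((d : ℚ) / 2 * (((k : ℚ) + 1 / 2 - d / 2) ^ 2 + (d : ℚ) ^ 2 / 12)) ^ (g + h)
      = ((d : ℚ) / 2) ^ (g + h) * ∑ m ∈ Finset.range (g + h + 1),
        ((d : ℚ) ^ 2 / 12) ^ (g + h - m) * ((g + h).choose m : ℚ) *
          (((2 * m).factorial : ℚ) * (∏ i, (b i : ℚ)) *
            PowerSeries.coeff (2 * m) (PowerSeries.X ^ (2 * h) * T)) := by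
    have h2 : ∀ m, ((2 * m).factorial : ℚ) * (∏ i, (b i : ℚ)) *
        PowerSeries.coeff (2 * m) (PowerSeries.X ^ (2 * h) * T)
        = ∑ k ∈ Finset.range d, (hookPoly (Multiset.map b Finset.univ.val)).coeff k *
          ((k : ℚ) + 1 / 2 - d / 2) ^ (2 * m) := by
      intro m
      rw [sum_coeff_hookPoly_mul_pow ⟨h, rfl⟩ b hb hsum, hT]
      rfl
    simp only [h2, Finset.mul_sum]
    rw [Finset.sum_comm]
    refine Finset.sum_congr rfl fun k _ => ?_
    rw [mul_pow, add_pow, Finset.mul_sum, Finset.mul_sum]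
    refine Finset.sum_congr rfl fun m _ => ?_
    rw [pow_mul]
    ring
  -- The first `h` values of `m` vanish because of the factor `X ^ (2 * h)`; the others are `m = h +
  -- j` with `j ≤ g`.
  rw [h1, show g + h + 1 = h + (g + 1) by ring, Finset.sum_range_add, Finset.sum_eq_zero, zero_add,
    ← mul_assoc, Finset.mul_sum, Finset.mul_sum]
  · refine Finset.sum_congr rfl fun j hj => ?_
    have hj' := Finset.mem_range.1 hj
    rw [show 2 * (h + j) = 2 * j + 2 * h by ring, PowerSeries.coeff_X_pow_mul, momentWeight,
      show 2 * (h + j) = 2 * j + 2 * h by ring, show g + h - (h + j) = g - j by omega]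
    -- Positivity of the exponent `g + h` lets `d^{g+h}` absorb the prefactor `1/d`.
    obtain ⟨s, hs'⟩ := Nat.exists_eq_succ_of_ne_zero hgh
    rw [hs', Nat.succ_sub_one, Nat.succ_eq_add_one, pow_add _ s (2 * (g - j)), pow_mul _ 2, div_pow,
      div_pow]
    field_simp
    ring
  · intro m hm
    have hm' := Finset.mem_range.1 hm
    rw [PowerSeries.coeff_X_pow_mul', if_neg (by omega)]
    simp

end Polynomiality

end Hurwitz

end

/-! ### Strong polynomiality, with `n = 2h + 1` and `s = g + h`. -/

theorem corollary4p1 (g n : ℕ) (hn : Odd n) (hgn : ¬ (g = 0 ∧ n = 1)) :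
    ∃ P : MvPolynomial (Fin n) ℚ,
      (∀ (d : ℕ) (β : d.Partition) (b : Fin n → ℕ),
        β.parts = Multiset.map b Finset.univ.val →
        ∃ (s : ℕ) (hs : 2 * s + 2 = 2 * g
            + Multiset.card (Nat.Partition.indiscrete d).parts + Multiset.card β.parts),
          Hurwitz.doubleHurwitz g 2 s (Nat.Partition.indiscrete d) β hs
            = MvPolynomial.eval (fun i => (b i : ℚ)) P) ∧
      (∃ hi : ℕ, (hi : ℚ) = 3 * (g : ℚ) + ((n : ℚ) - 3) / 2 ∧
        IsGreatest (Hurwitz.homogeneousDegrees P) hi) ∧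
      (∃ lo : ℕ, (lo : ℚ) = (g : ℚ) + ((n : ℚ) - 3) / 2 ∧
        IsLeast (Hurwitz.homogeneousDegrees P) lo) := by
  obtain ⟨h, rfl⟩ := hn
  have hgh : g + h ≠ 0 := by omega
  have hcast : ((g + h - 1 : ℕ) : ℚ) = (g : ℚ) + h - 1 := by
    rw [Nat.cast_sub (Nat.one_le_iff_ne_zero.2 hgh)]
    push_cast
    ring
  refine ⟨Hurwitz.hurwitzPoly g h, ?_, ⟨g + h - 1 + 2 * g, ?_,
    Hurwitz.isGreatest_homogeneousDegrees_hurwitzPoly g h⟩, ⟨g + h - 1, ?_,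
    Hurwitz.isLeast_homogeneousDegrees_hurwitzPoly g h⟩⟩
  · intro d β b hβ
    -- Needed because `Nat.Partition.indiscrete 0` has no part, which would spoil the count
    -- determining `s`.
    have hd : d ≠ 0 := by
      rintro rfl
      have h1 : b 0 ∈ β.parts := by
        rw [hβ]
        exact Multiset.mem_map_of_mem b (Finset.mem_univ_val 0)
      have h2 := Multiset.single_le_sum (fun _ _ => Nat.zero_le _) _ h1
      have h3 := β.parts_pos h1
      rw [β.parts_sum] at h2
      omega
    refine ⟨g + h, ?_, Hurwitz.doubleHurwitz_eq_eval g h hgh β b hβ _⟩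
    rw [Nat.Partition.indiscrete_parts hd, hβ]
    simp
    ring
  · push_cast
    rw [hcast]
    ring
  · rw [hcast]
    push_cast
    ring
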